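/- Nodes form a homogeneous Poisson point process with density $\lambda>0$ on a Borel region $\mathcal A\subset\mathbb R^2$ of finite area. A drone hovers at altitude $h>0$ above the centre $c$ of a closed disk $\mathcal A_\mu\subseteq\mathcal A$ of radius $R>0$; put $d=\sqrt{h^2+R^2}$ and $D_x=\sqrt{|x-c|^2+h^2}$. In a given slot each node in $\mathcal A_\mu$ transmits with probability $a\in[0,1]$; $\tilde\Psi_\mu$ denotes the set of transmitting nodes of $\mathcal A_\mu$. Each node $x$ has a Gamma distributed gain $G_x$ with density $m^m g^{m-1}e^{-mg}/\Gamma(m)$, $g>0$, where $m\ge 1$ is an integer. All transmission decisions and gains are independent of each other and of the node positions. With transmission power $P>0$, path loss exponent $\eta>0$ and noise variance $\sigma_n^2>0$, put for $x\in\tilde\Psi_\mu$ $$\mathrm{SINR}_x=\frac{P G_xD_x^{-\eta}}{\sum_{y\in\tilde\Psi_\mu\setminus\{x\}}P G_yD_y^{-\eta}+\sigma_n^2},\qquad I_x=\sum_{y\in\tilde\Psi_\mu\setminus\{x\}}G_yD_y^{-\eta}+\frac{\sigma_n^2}{P},$$ $$\mathcal L_I(s)=e^{-s\sigma_n^2/P}\exp\Big(-2\pi\lambda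 a\int_h^d\Big(1-\big(1+\tfrac{s r^{-\eta}}{m}\big)^{-m}\Big)r\,dr\Big).$$ Let $\mathcal A_{int}=\mathcal A_{mse}\cap\mathcal A_\mu$, where $\mathcal A_{mse}$ is the closed disk of radius $R_{mse}>0$ centred at a point of the boundary circle of $\mathcal A_\mu$. Theorem. For every SINR threshold $\beta\ge 1$, the probability of a successful transmission from $\mathcal A_{int}$, that is, the probability $P_e^s$ that some $x\in\tilde\Psi_\mu\cap\mathcal A_{int}$ has $\mathrm{SINR}_x\ge\beta$, is $$P_e^s=a\lambda\int_h^d\ \sum_{k=0}^{m-1}\frac{(-m\beta r^\eta)^k}{k!}\Big[\frac{\partial^k}{\partial s^k}\mathcal L_I(s)\Big]_{s=m\beta r^\eta}\, r\,\theta\big(\sqrt{r^2-h^2}\big)\,dr,$$ where $$\theta(w)=\begin{cases}2\pi,&0\le w\le\max(0,R_{mse}-R),\\ 2\arccos\Big(\dfrac{R^2+w^2-R_{mse}^2}{2Rw}\Big),&|R_{mse}-R|\le w\le R_{mse}+R\text{ (and the first case does not apply)},\\ 0,&\text{otherwise.}\end{cases}$$ Here $\mathcal L_I$ is the Laplace transform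 of the normalized interference plus noise seen by the signal of an active node: for all $s\ge 0$ and all Borel sets $B\subseteq\mathcal A_\mu$, with $|B|$ the area of $B$, $$\mathbb E\sum_{x\in\tilde\Psi_\mu\cap B}e^{-sI_x}=a\lambda\,|B|\,\mathcal L_I(s).$$ -/

import Mathlib

open MeasureTheory ProbabilityTheory

noncomputable section

namespace UAV

/-- The ground plane with its Euclidean distance and Lebesgue measure. -/
abbrev Plane : Type := EuclideanSpace ℝ (Fin 2)

open Classical in
/-- The number of points of the finite configuration `X 0, …, X (n - 1)` that lie in `B`. -/
def countIn (n : ℕ) (X : ℕ → Plane) (B : Set Plane) : ℕ :=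
  ((Finset.range n).filter (fun i => X i ∈ B)).card

/-- The random configuration `X 0 ω, …, X (N ω - 1) ω` is a homogeneous Poisson point process
with density `lam` on the region `𝒜`: the number of points in a Borel set `B` has the Poisson
law with mean `lam * |B ∩ 𝒜|`, and the numbers of points in disjoint Borel sets are
independent. -/
structure IsHomogeneousPPP {Ω : Type*} [MeasurableSpace Ω] (Pr : Measure Ω)
    (lam : ℝ) (𝒜 : Set Plane) (N : Ω → ℕ) (X : ℕ → Ω → Plane) : Prop where
  measurable_number : Measurable N
  measurable_position : ∀ i, Measurable (X i)
  count_law : ∀ B : Set Plane, MeasurableSet B →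
    Pr.map (fun ω => countIn (N ω) (fun i => X i ω) B) =
      poissonMeasure (lam * volume.real (B ∩ 𝒜)).toNNReal
  count_indep : ∀ (n : ℕ) (B : Fin n → Set Plane), (∀ j, MeasurableSet (B j)) →
    Pairwise (fun j l => Disjoint (B j) (B l)) →
    iIndepFun (fun j ω => countIn (N ω) (fun i => X i ω) (B j)) Pr

/-- One slot of the network. The nodes form a homogeneous Poisson point process; node `i`
transmits (`T i = true`) with probability `a` and has a Gamma distributed power gain `G i` with
density `m ^ m * g ^ (m - 1) / Γ(m) * exp (-m * g)`. All these decisions and gains are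
independent of one another and of the node positions. -/
structure IsSlot {Ω : Type*} [MeasurableSpace Ω] (Pr : Measure Ω)
    (lam a : ℝ) (m : ℕ) (𝒜 : Set Plane)
    (N : Ω → ℕ) (X : ℕ → Ω → Plane) (T : ℕ → Ω → Bool) (G : ℕ → Ω → ℝ) : Prop where
  nodes : IsHomogeneousPPP Pr lam 𝒜 N X
  measurable_decision : ∀ i, Measurable (T i)
  measurable_gain : ∀ i, Measurable (G i)
  decision_law : ∀ i, Pr.real {ω | T i ω = true} = a
  gain_law : ∀ i, Pr.map (G i) = gammaMeasure m m
  decision_indep_gain : ∀ i, IndepFun (T i) (G i) Pr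
  marks_indep : iIndepFun (fun i ω => (T i ω, G i ω)) Pr
  marks_indep_nodes :
    IndepFun (fun ω => (N ω, fun i => X i ω)) (fun ω i => (T i ω, G i ω)) Pr

/-- The distance between a ground node at `x` and the drone at altitude `h` above `c`. -/
def droneDist (c : Plane) (h : ℝ) (x : Plane) : ℝ := √(dist x c ^ 2 + h ^ 2)

open Classical in
/-- The indices of the nodes that lie in the hovering disk (centre `c`, radius `R`) and transmit:
the active nodes of the slot. -/
def active (c : Plane) (R : ℝ) (n : ℕ) (X : ℕ → Plane) (T : ℕ → Bool) : Finset ℕ :=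
  (Finset.range n).filter (fun i => X i ∈ Metric.closedBall c R ∧ T i = true)

/-- Signal to interference plus noise ratio of node `i` when `S` is the set of active nodes,
`Pt` the transmission power, `η` the path loss exponent and `σ2` the noise variance. -/
def sinr (Pt η σ2 : ℝ) (c : Plane) (h : ℝ) (S : Finset ℕ) (X : ℕ → Plane) (G : ℕ → ℝ)
    (i : ℕ) : ℝ :=
  Pt * G i * droneDist c h (X i) ^ (-η) /
    (∑ j ∈ S.erase i, Pt * G j * droneDist c h (X j) ^ (-η) + σ2)

/-- Interference plus noise seen by the signal of node `i`, normalized by the transmission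
power. -/
def interference (Pt η σ2 : ℝ) (c : Plane) (h : ℝ) (S : Finset ℕ) (X : ℕ → Plane) (G : ℕ → ℝ)
    (i : ℕ) : ℝ :=
  ∑ j ∈ S.erase i, G j * droneDist c h (X j) ^ (-η) + σ2 / Pt

/-- The closed form of the Laplace transform of the normalized interference plus noise. -/
def laplaceI (lam a Pt η σ2 h R : ℝ) (m : ℕ) (s : ℝ) : ℝ :=
  Real.exp (-s * σ2 / Pt) *
    Real.exp (-2 * Real.pi * lam * a *
      ∫ r in h..√(h ^ 2 + R ^ 2), (1 - (1 + s * r ^ (-η) / m) ^ (-(m : ℤ))) * r)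

/-- The angular factor of the intersection of a disk of radius `R` with a disk of radius `Rmse`
centred on its edge, at distance `w` from the centre of the first disk. -/
def theta (R Rmse w : ℝ) : ℝ :=
  if 0 ≤ w ∧ w ≤ max 0 (Rmse - R) then 2 * Real.pi
  else if |Rmse - R| ≤ w ∧ w ≤ Rmse + R then
    2 * Real.arccos ((R ^ 2 + w ^ 2 - Rmse ^ 2) / (2 * R * w))
  else 0

end UAV

end

/-!
The marked nodes `(X i, T i, G i)` form a Poisson process, as its probability generating
functional shows. Tilting the law by the exponential of a shot noise gives again a Poisson process,
so the mean number of its points in a set is known; by uniqueness of Laplace transforms this is the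
Slivnyak–Mecke formula. Hence an active node sees an interference distributed as the total
interference `J` of the slot, independent of its own position and gain, and the generating
functional in polar coordinates gives `E exp (-s J) = laplaceI s`.

For `β ≥ 1` at most one node succeeds, since its received power exceeds that of every other active
node. The probability of success is therefore the mean number of successful nodes, that is, the
integral over the lens of the mean of `P(G ≥ β D ^ η J)`. For an integer shape the Gamma tail is a
Poisson sum, whose mean is a combination of derivatives of `laplaceI` at `m β D ^ η`, and `theta`
is the angle that the lens subtends at each distance from the centre of the disk.
-/

noncomputable section

namespace UAV

open Filter Topology
open scoped ENNReal

section ShotNoise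

variable {E : Type*}

/-- The shot noise of the configuration `y 0, …, y (n - 1)`: the total effect of its points
when a point at `y` has effect `u y`. -/
def shotNoise (u : E → ℝ) (n : ℕ) (y : ℕ → E) : ℝ := ∑ i ∈ Finset.range n, u (y i)

lemma shotNoise_nonneg {u : E → ℝ} (hu : ∀ y, 0 ≤ u y) (n : ℕ) (y : ℕ → E) :
    0 ≤ shotNoise u n y := Finset.sum_nonneg fun _ _ => hu _

lemma mul_shotNoise (s : ℝ) (u : E → ℝ) (n : ℕ) (y : ℕ → E) :
    s * shotNoise u n y = shotNoise (fun y => s * u y) n y := Finset.mul_sum ..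

lemma exp_shotNoise (u : E → ℝ) (n : ℕ) (y : ℕ → E) :
    Real.exp (shotNoise u n y) = ∏ i ∈ Finset.range n, Real.exp (u (y i)) := Real.exp_sum ..

end ShotNoise

section LaplaceUniqueness

lemma hasSum_complexMGF_id {μ : Measure ℝ} [IsFiniteMeasure μ] {C : ℝ}
    (hC : ∀ᵐ x ∂μ, |x| ≤ C) (z : ℂ) :
    HasSum (fun k : ℕ => z ^ k / k.factorial * ((∫ x, x ^ k ∂μ : ℝ) : ℂ)) (complexMGF id μ z) := by
  have hbound (k : ℕ) : ∀ᵐ x : ℝ ∂μ,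
      ‖z ^ k / k.factorial * ((x ^ k : ℝ) : ℂ)‖ ≤ (‖z‖ * C) ^ k / k.factorial := by
    filter_upwards [hC] with x hx
    rw [norm_mul, norm_div, norm_pow, Complex.norm_natCast, Complex.norm_real, norm_pow,
      Real.norm_eq_abs, mul_pow, div_mul_eq_mul_div]
    gcongr
  have hint (k : ℕ) : Integrable (fun x : ℝ => z ^ k / k.factorial * ((x ^ k : ℝ) : ℂ)) μ :=
    (integrable_const _).mono' (by fun_prop) (hbound k)
  have hsum : Summable fun k => ∫ x : ℝ, ‖z ^ k / k.factorial * ((x ^ k : ℝ) : ℂ)‖ ∂μ :=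
    .of_nonneg_of_le (fun k => integral_nonneg fun _ => norm_nonneg _)
      (fun k => integral_mono_ae (hint k).norm (integrable_const _) (hbound k))
      (by simpa using (Real.summable_pow_div_factorial (‖z‖ * C)).mul_left (μ.real Set.univ))
  have hexp : complexMGF id μ z = ∫ x, ∑' k : ℕ, z ^ k / k.factorial * ((x ^ k : ℝ) : ℂ) ∂μ := by
    refine integral_congr_ae (ae_of_all _ fun x => ?_)
    have h := NormedSpace.expSeries_div_hasSum_exp (z * x)
    rw [← Complex.exp_eq_exp_ℂ] at h
    simp only [id, ← h.tsum_eq, mul_pow, Complex.ofReal_pow, div_mul_eq_mul_div]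
  rw [hexp]
  refine (hasSum_integral_of_summable_integral_norm hint hsum).congr_fun fun k => ?_
  rw [integral_const_mul, integral_complex_ofReal]

lemma measure_ext_of_moments {μ ν : Measure ℝ} [IsFiniteMeasure μ] [IsFiniteMeasure ν] {C : ℝ}
    (hμ : ∀ᵐ x ∂μ, |x| ≤ C) (hν : ∀ᵐ x ∂ν, |x| ≤ C)
    (h : ∀ k : ℕ, ∫ x, x ^ k ∂μ = ∫ x, x ^ k ∂ν) : μ = ν := by
  refine Measure.ext_of_complexMGF_id_eq (funext fun z => ?_)
  refine (hasSum_complexMGF_id hμ z).unique ?_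
  simpa only [h] using hasSum_complexMGF_id hν z

/-- The change of variable `y = exp (-x)` turns the values of the Laplace transform at the integers
into the moments of a measure on `[0, 1]`. -/
theorem measure_ext_of_laplace {μ ν : Measure ℝ} [IsFiniteMeasure μ] [IsFiniteMeasure ν]
    (hμ : ∀ᵐ x ∂μ, 0 ≤ x) (hν : ∀ᵐ x ∂ν, 0 ≤ x)
    (h : ∀ k : ℕ, ∫⁻ x, ENNReal.ofReal (Real.exp (-(k * x))) ∂μ =
      ∫⁻ x, ENNReal.ofReal (Real.exp (-(k * x))) ∂ν) : μ = ν := by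
  have hexp : Measurable fun x : ℝ => Real.exp (-x) := by fun_prop
  have hbound {ρ : Measure ℝ} (hρ : ∀ᵐ x ∂ρ, 0 ≤ x) :
      ∀ᵐ y ∂ρ.map fun x => Real.exp (-x), |y| ≤ 1 := by
    refine (ae_map_iff hexp.aemeasurable (measurableSet_le measurable_id.abs measurable_const)).2 ?_
    filter_upwards [hρ] with x hx
    rwa [id, Real.abs_exp, Real.exp_le_one_iff, neg_nonpos]
  have hmoment (ρ : Measure ℝ) (k : ℕ) : ∫ y, y ^ k ∂(ρ.map fun x => Real.exp (-x)) =
      (∫⁻ x, ENNReal.ofReal (Real.exp (-(k * x))) ∂ρ).toReal := by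
    rw [integral_map hexp.aemeasurable (by fun_prop), integral_eq_lintegral_of_nonneg_ae
      (ae_of_all _ fun x => by positivity) (by fun_prop)]
    simp only [← Real.exp_nat_mul, mul_neg]
  have hback (ρ : Measure ℝ) : (ρ.map fun x => Real.exp (-x)).map (fun y => -Real.log y) = ρ := by
    rw [Measure.map_map (by fun_prop) hexp]
    simp [Function.comp_def]
  rw [← hback μ, ← hback ν, measure_ext_of_moments (hbound hμ) (hbound hν) fun k => by
    rw [hmoment, hmoment, h k]]

lemma measure_prod_ext_of_laplace {E : Type*} [MeasurableSpace E] {μ ν : Measure (E × ℝ)}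
    [IsFiniteMeasure μ] [IsFiniteMeasure ν] (hμ : ∀ᵐ p ∂μ, 0 ≤ p.2) (hν : ∀ᵐ p ∂ν, 0 ≤ p.2)
    (h : ∀ B : Set E, MeasurableSet B → ∀ k : ℕ,
      ∫⁻ p in Prod.fst ⁻¹' B, ENNReal.ofReal (Real.exp (-(k * p.2))) ∂μ =
        ∫⁻ p in Prod.fst ⁻¹' B, ENNReal.ofReal (Real.exp (-(k * p.2))) ∂ν) : μ = ν := by
  refine Measure.ext_prod fun {B D} hB hD => ?_
  have hnonneg {ρ : Measure (E × ℝ)} (hρ : ∀ᵐ p ∂ρ, 0 ≤ p.2) :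
      ∀ᵐ t ∂(ρ.restrict (Prod.fst ⁻¹' B)).map Prod.snd, 0 ≤ t :=
    (ae_map_iff measurable_snd.aemeasurable measurableSet_Ici).2 (ae_restrict_of_ae hρ)
  have hsection : (μ.restrict (Prod.fst ⁻¹' B)).map Prod.snd =
      (ν.restrict (Prod.fst ⁻¹' B)).map Prod.snd :=
    measure_ext_of_laplace (hnonneg hμ) (hnonneg hν) fun k => by
      rw [lintegral_map (by fun_prop) measurable_snd, lintegral_map (by fun_prop) measurable_snd,
        h B hB k]
  have hBD (ρ : Measure (E × ℝ)) :
      (ρ.restrict (Prod.fst ⁻¹' B)).map Prod.snd D = ρ (B ×ˢ D) := by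
    rw [Measure.map_apply measurable_snd hD, Measure.restrict_apply (measurable_snd hD),
      Set.inter_comm, Set.prod_eq]
  rw [← hBD μ, hsection, hBD ν]

end LaplaceUniqueness

section PPP

variable {Ω E : Type*} [MeasurableSpace Ω] [MeasurableSpace E]

/-- The random configuration `Y 0 ω, …, Y (N ω - 1) ω` is a Poisson process with intensity `Λ`.
The law is encoded by its probability generating functional on bounded weights, a form that
passes directly to marked and to exponentially tilted processes; the intensity is finite because
the points are listed by their random number. -/
structure IsPPP (Pr : Measure Ω) (Λ : Measure E) (N : Ω → ℕ) (Y : ℕ → Ω → E) :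
    Prop where
  isFiniteMeasure_intensity : IsFiniteMeasure Λ
  measurable_number : Measurable N
  measurable_point : ∀ i, Measurable (Y i)
  lintegral_prod_ofReal : ∀ {w : E → ℝ} {M : ℝ}, Measurable w → (∀ y, w y ∈ Set.Icc 0 M) →
    ∫⁻ ω, ∏ i ∈ Finset.range (N ω), ENNReal.ofReal (w (Y i ω)) ∂Pr =
      ENNReal.ofReal (Real.exp (∫ y, (w y - 1) ∂Λ))

/-- The Campbell measure of the points of a random configuration, each paired with the global
random variable `Z`: the mean number of points `Y i` for which `(Y i, Z)` lies in a given set. -/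
def campbellMeasure {F : Type*} [MeasurableSpace F] (Pr : Measure Ω) (N : Ω → ℕ) (Y : ℕ → Ω → E)
    (Z : Ω → F) : Measure (E × F) :=
  Measure.sum fun i => (Pr.restrict {ω | i < N ω}).map fun ω => (Y i ω, Z ω)

lemma measurable_apply_nat {F : Type*} [MeasurableSpace F] {N : Ω → ℕ}
    (hN : Measurable N) {f : ℕ → Ω → F} (hf : ∀ n, Measurable (f n)) :
    Measurable fun ω => f (N ω) ω :=
  (measurable_from_prod_countable_right (f := fun p : ℕ × Ω => f p.1 p.2) hf).comp
    (hN.prodMk measurable_id)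

lemma lintegral_comp_prodMk_of_indepFun {F G : Type*} [MeasurableSpace F] [MeasurableSpace G]
    {Pr : Measure Ω} [IsFiniteMeasure Pr] {U : Ω → F} {V : Ω → G} (hU : Measurable U)
    (hV : Measurable V) (h : IndepFun U V Pr) {f : F × G → ℝ≥0∞} (hf : Measurable f) :
    ∫⁻ ω, f (U ω, V ω) ∂Pr = ∫⁻ ω, ∫⁻ ω', f (U ω, V ω') ∂Pr ∂Pr := by
  rw [← lintegral_map hf (hU.prodMk hV),
    (indepFun_iff_map_prod_eq_prod_map_map hU.aemeasurable hV.aemeasurable).1 h,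
    lintegral_prod _ hf.aemeasurable, lintegral_map hf.lintegral_prod_right' hU]
  exact lintegral_congr fun ω => lintegral_map (hf.comp measurable_prodMk_left) hV

lemma lintegral_prod_marks {K : Type*} [MeasurableSpace K] {Pr : Measure Ω} {κ : Measure K}
    {τ : ℕ → Ω → K} (hτ : ∀ i, Measurable (τ i)) (hind : iIndepFun τ Pr)
    (hlaw : ∀ i, Pr.map (τ i) = κ) {f : ℕ → K → ℝ≥0∞} (hf : ∀ i, Measurable (f i)) (n : ℕ) :
    ∫⁻ ω, ∏ i ∈ Finset.range n, f i (τ i ω) ∂Pr =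
      ∏ i ∈ Finset.range n, ∫⁻ t, f i t ∂κ := by
  rw [lintegral_prod_eq_prod_lintegral_of_indepFun (Finset.range n) (fun i ω => f i (τ i ω))
    (hind.comp f hf) fun i => (hf i).comp (hτ i)]
  exact Finset.prod_congr rfl fun i _ => by rw [← hlaw i, lintegral_map (hf i) (hτ i)]

lemma integrable_of_mem_Icc {μ : Measure E} [IsFiniteMeasure μ] {w : E → ℝ} {M : ℝ}
    (hw : Measurable w) (hw' : ∀ y, w y ∈ Set.Icc 0 M) : Integrable w μ :=
  .of_mem_Icc 0 M hw.aemeasurable (ae_of_all _ hw')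

namespace IsPPP

variable {F : Type*} [MeasurableSpace F] {Pr : Measure Ω} {Λ : Measure E} {N : Ω → ℕ}
  {Y : ℕ → Ω → E}

lemma isProbabilityMeasure (hY : IsPPP Pr Λ N Y) : IsProbabilityMeasure Pr :=
  ⟨by simpa using hY.lintegral_prod_ofReal (w := fun _ => 1) (M := 1) measurable_const (by simp)⟩

lemma measurable_sum (hY : IsPPP Pr Λ N Y) {f : ℕ → Ω → ℝ≥0∞}
    (hf : ∀ i, Measurable (f i)) : Measurable fun ω => ∑ i ∈ Finset.range (N ω), f i ω :=
  measurable_apply_nat hY.measurable_number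
    (f := fun n ω => ∑ i ∈ Finset.range n, f i ω)
    fun _ => Finset.measurable_fun_sum _ fun i _ => hf i

lemma measurable_prod_weight (hY : IsPPP Pr Λ N Y) {w : E → ℝ≥0∞} (hw : Measurable w) :
    Measurable fun ω => ∏ i ∈ Finset.range (N ω), w (Y i ω) :=
  measurable_apply_nat hY.measurable_number
    (f := fun n ω => ∏ i ∈ Finset.range n, w (Y i ω))
    fun _ => Finset.measurable_fun_prod _ fun i _ => hw.comp (hY.measurable_point i)

lemma measurable_shotNoise (hY : IsPPP Pr Λ N Y) {u : E → ℝ} (hu : Measurable u) :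
    Measurable fun ω => shotNoise u (N ω) fun i => Y i ω :=
  measurable_apply_nat hY.measurable_number
    (f := fun n ω => shotNoise u n fun i => Y i ω)
    fun _ => Finset.measurable_fun_sum _ fun i _ => hu.comp (hY.measurable_point i)

lemma measurable_prodMk_shotNoise_add (hY : IsPPP Pr Λ N Y) {u : E → ℝ}
    (hu : Measurable u) :
    Measurable fun p : E × Ω => (p.1, (shotNoise u (N p.2) fun i => Y i p.2) + u p.1) :=
  measurable_fst.prodMk
    (((hY.measurable_shotNoise hu).comp measurable_snd).add (hu.comp measurable_fst))

lemma integral_exp_shotNoise (hY : IsPPP Pr Λ N Y) {u : E → ℝ} {C : ℝ}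
    (hu : Measurable u) (hC : ∀ y, u y ≤ C) :
    ∫ ω, Real.exp (shotNoise u (N ω) fun i => Y i ω) ∂Pr =
      Real.exp (∫ y, (Real.exp (u y) - 1) ∂Λ) := by
  rw [integral_eq_lintegral_of_nonneg_ae (ae_of_all _ fun _ => (Real.exp_pos _).le)
    (hY.measurable_shotNoise hu).exp.aestronglyMeasurable,
    ← ENNReal.toReal_ofReal (Real.exp_pos (∫ y, (Real.exp (u y) - 1) ∂Λ)).le,
    ← hY.lintegral_prod_ofReal hu.exp (M := Real.exp C) fun y =>
      ⟨by positivity, Real.exp_le_exp.2 (hC y)⟩]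
  simp only [exp_shotNoise, ENNReal.ofReal_prod_of_nonneg fun _ _ => (Real.exp_pos _).le]

lemma mgf_shotNoise (hY : IsPPP Pr Λ N Y) {u : E → ℝ} {t C : ℝ}
    (hu : Measurable u) (hC : ∀ y, t * u y ≤ C) :
    mgf (fun ω => shotNoise u (N ω) fun i => Y i ω) Pr t =
      Real.exp (∫ y, (Real.exp (t * u y) - 1) ∂Λ) := by
  simp only [mgf, mul_shotNoise]
  exact hY.integral_exp_shotNoise (hu.const_mul t) hC

lemma integrable_exp_shotNoise (hY : IsPPP Pr Λ N Y) {u : E → ℝ} {C : ℝ}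
    (hu : Measurable u) (hC : ∀ y, u y ≤ C) :
    Integrable (fun ω => Real.exp (shotNoise u (N ω) fun i => Y i ω)) Pr :=
  .of_integral_ne_zero (by rw [hY.integral_exp_shotNoise hu hC]; positivity)

lemma tilted (hY : IsPPP Pr Λ N Y) {u : E → ℝ} {C : ℝ}
    (hu : Measurable u) (hC : ∀ y, u y ≤ C) :
    IsPPP (Pr.tilted fun ω => shotNoise u (N ω) fun i => Y i ω)
      (Λ.withDensity fun y => ENNReal.ofReal (Real.exp (u y))) N Y := by
  have := hY.isFiniteMeasure_intensity
  have hexp (y : E) : Real.exp (u y) ∈ Set.Icc 0 (Real.exp C) :=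
    ⟨by positivity, Real.exp_le_exp.2 (hC y)⟩
  have hint : Integrable (fun y => Real.exp (u y)) Λ := integrable_of_mem_Icc hu.exp hexp
  refine ⟨isFiniteMeasure_withDensity_ofReal hint.2, hY.measurable_number,
    hY.measurable_point, fun {w M} hw hw' => ?_⟩
  have hwexp_meas : Measurable fun y => w y * Real.exp (u y) := hw.mul hu.exp
  have hwexp (y : E) : w y * Real.exp (u y) ∈ Set.Icc 0 (M * Real.exp C) :=
    ⟨mul_nonneg (hw' y).1 (hexp y).1,
      mul_le_mul (hw' y).2 (hexp y).2 (hexp y).1 ((hw' y).1.trans (hw' y).2)⟩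
  have hprod (n : ℕ) (y : ℕ → E) :
      ENNReal.ofReal (Real.exp (shotNoise u n y) / Real.exp (∫ y, (Real.exp (u y) - 1) ∂Λ)) *
        ∏ i ∈ Finset.range n, ENNReal.ofReal (w (y i)) =
      ENNReal.ofReal (Real.exp (-∫ y, (Real.exp (u y) - 1) ∂Λ)) *
        ∏ i ∈ Finset.range n, ENNReal.ofReal (w (y i) * Real.exp (u (y i))) := by
    simp only [div_eq_inv_mul, ← Real.exp_neg, exp_shotNoise,
      ENNReal.ofReal_mul (Real.exp_pos _).le, ENNReal.ofReal_mul (hw' _).1,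
      ENNReal.ofReal_prod_of_nonneg fun _ _ => (Real.exp_pos _).le, Finset.prod_mul_distrib]
    ring
  have hexponent : -∫ y, (Real.exp (u y) - 1) ∂Λ + ∫ y, (w y * Real.exp (u y) - 1) ∂Λ =
      ∫ y, (w y - 1) ∂Λ.withDensity fun y => ENNReal.ofReal (Real.exp (u y)) := by
    have hwint : Integrable (fun y => w y * Real.exp (u y) - 1) Λ :=
      (integrable_of_mem_Icc hwexp_meas hwexp).sub (integrable_const 1)
    have hint' : Integrable (fun y => Real.exp (u y) - 1) Λ := hint.sub (integrable_const 1)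
    rw [integral_withDensity_eq_integral_toReal_smul (by fun_prop) (by simp), neg_add_eq_sub,
      ← integral_sub hwint hint']
    simp only [ENNReal.toReal_ofReal (hexp _).1, smul_eq_mul]
    congr! 2
    ring
  simp only [lintegral_tilted, hY.integral_exp_shotNoise hu hC, hprod]
  rw [lintegral_const_mul _ (hY.measurable_prod_weight hwexp_meas.ennreal_ofReal),
    hY.lintegral_prod_ofReal hwexp_meas hwexp, ← ENNReal.ofReal_mul (Real.exp_pos _).le,
    ← Real.exp_add, hexponent]

lemma lintegral_sum_indicator_one (hY : IsPPP Pr Λ N Y) {B : Set E}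
    (hB : MeasurableSet B) :
    ∫⁻ ω, ∑ i ∈ Finset.range (N ω), B.indicator 1 (Y i ω) ∂Pr = Λ B := by
  have := hY.isFiniteMeasure_intensity
  set S : Ω → ℝ := fun ω => shotNoise (B.indicator 1) (N ω) fun i => Y i ω with hS
  have hmeas : Measurable (B.indicator (1 : E → ℝ)) := measurable_one.indicator hB
  have hle (t : ℝ) (y : E) : t * B.indicator 1 y ≤ |t| := by
    by_cases hy : y ∈ B <;> simp [hy, le_abs_self]
  have hset : integrableExpSet S Pr = Set.univ := Set.eq_univ_of_forall fun t => by
    simpa only [integrableExpSet, Set.mem_ofPred_eq, hS, mul_shotNoise] using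
      hY.integrable_exp_shotNoise (hmeas.const_mul t) (hle t)
  have hmgf : mgf S Pr = fun t => Real.exp ((Real.exp t - 1) * Λ.real B) := by
    ext t
    have hind (y : E) : Real.exp (t * B.indicator 1 y) - 1 =
        B.indicator (fun _ => Real.exp t - 1) y := by by_cases hy : y ∈ B <;> simp [hy]
    rw [hY.mgf_shotNoise hmeas (hle t)]
    simp only [hind, integral_indicator_const _ hB, smul_eq_mul, mul_comm]
  have hmean : ∫ ω, S ω ∂Pr = Λ.real B := by
    rw [← deriv_mgf_zero (by simp [hset]), hmgf]
    have hd := (((Real.hasDerivAt_exp 0).sub_const 1).mul_const (Λ.real B)).exp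
    simpa using hd.deriv
  have hint : Integrable S Pr := integrable_of_mem_interior_integrableExpSet (by simp [hset])
  rw [← ofReal_measureReal, ← hmean, ofReal_integral_eq_lintegral_ofReal hint
    (ae_of_all _ fun ω => shotNoise_nonneg (fun y => Set.indicator_nonneg (by simp) y) _ _)]
  refine lintegral_congr fun ω => ?_
  simp only [hS, shotNoise]
  rw [ENNReal.ofReal_sum_of_nonneg fun i _ => Set.indicator_nonneg (by simp) _]
  refine Finset.sum_congr rfl fun i _ => ?_
  by_cases hy : Y i ω ∈ B <;> simp [hy]

lemma lintegral_campbellMeasure (hY : IsPPP Pr Λ N Y) {Z : Ω → F} (hZ : Measurable Z)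
    {f : E × F → ℝ≥0∞} (hf : Measurable f) :
    ∫⁻ p, f p ∂campbellMeasure Pr N Y Z =
      ∫⁻ ω, ∑ i ∈ Finset.range (N ω), f (Y i ω, Z ω) ∂Pr := by
  have hmeas (i : ℕ) : Measurable fun ω => (Y i ω, Z ω) := (hY.measurable_point i).prodMk hZ
  have hfm (i : ℕ) : Measurable fun ω => f (Y i ω, Z ω) := hf.comp (hmeas i)
  have hset (i : ℕ) : MeasurableSet {ω | i < N ω} := hY.measurable_number measurableSet_Ioi
  have hterm (i : ℕ) : ∫⁻ p, f p ∂(Pr.restrict {ω | i < N ω}).map (fun ω => (Y i ω, Z ω)) =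
      ∫⁻ ω, {ω | i < N ω}.indicator (fun ω => f (Y i ω, Z ω)) ω ∂Pr := by
    rw [lintegral_map hf (hmeas i), lintegral_indicator (hset i)]
  rw [campbellMeasure, lintegral_sum_measure, tsum_congr hterm,
    ← lintegral_tsum fun i => ((hfm i).indicator (hset i)).aemeasurable]
  refine lintegral_congr fun ω => ?_
  rw [tsum_eq_sum (s := Finset.range (N ω)) fun i hi => Set.indicator_of_notMem
    (by simpa using hi) _]
  exact Finset.sum_congr rfl fun i hi => Set.indicator_of_mem (by simpa using hi) _

lemma isFiniteMeasure_campbellMeasure (hY : IsPPP Pr Λ N Y) {Z : Ω → F}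
    (hZ : Measurable Z) : IsFiniteMeasure (campbellMeasure Pr N Y Z) := by
  have := hY.isFiniteMeasure_intensity
  refine ⟨?_⟩
  rw [← lintegral_one, hY.lintegral_campbellMeasure hZ measurable_const]
  simpa using (hY.lintegral_sum_indicator_one .univ).trans_lt (measure_lt_top Λ _)

lemma lintegral_sum_indicator_exp_shotNoise (hY : IsPPP Pr Λ N Y) {u : E → ℝ} {C : ℝ}
    (hu : Measurable u) (hC : ∀ y, u y ≤ C) {B : Set E} (hB : MeasurableSet B) :
    ∫⁻ ω, ∑ i ∈ Finset.range (N ω), B.indicator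
        (fun _ => ENNReal.ofReal (Real.exp (shotNoise u (N ω) fun i => Y i ω))) (Y i ω) ∂Pr =
      ∫⁻ y in B, ∫⁻ ω, ENNReal.ofReal
        (Real.exp ((shotNoise u (N ω) fun i => Y i ω) + u y)) ∂Pr ∂Λ := by
  have := hY.isProbabilityMeasure
  set S : Ω → ℝ := fun ω => shotNoise u (N ω) fun i => Y i ω with hS
  have hSm : Measurable S := hY.measurable_shotNoise hu
  have hint : Integrable (fun ω => Real.exp (S ω)) Pr := hY.integrable_exp_shotNoise hu hC
  have htilt := (hY.tilted hu hC).lintegral_sum_indicator_one hB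
  have hZ : 0 < ∫ ω, Real.exp (S ω) ∂Pr := integral_exp_pos hint
  rw [lintegral_tilted, withDensity_apply _ hB] at htilt
  calc _ = ∫⁻ ω, ENNReal.ofReal (∫ ω, Real.exp (S ω) ∂Pr) *
          (ENNReal.ofReal (Real.exp (S ω) / ∫ ω, Real.exp (S ω) ∂Pr) *
            ∑ i ∈ Finset.range (N ω), B.indicator 1 (Y i ω)) ∂Pr := by
        refine lintegral_congr fun ω => ?_
        rw [← mul_assoc, ← ENNReal.ofReal_mul hZ.le, mul_div_cancel₀ _ hZ.ne', Finset.mul_sum]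
        refine Finset.sum_congr rfl fun i _ => ?_
        by_cases hy : Y i ω ∈ B <;> simp [hy, hS]
    _ = ENNReal.ofReal (∫ ω, Real.exp (S ω) ∂Pr) *
          ∫⁻ y in B, ENNReal.ofReal (Real.exp (u y)) ∂Λ := by
        rw [lintegral_const_mul' _ _ ENNReal.ofReal_ne_top, htilt]
    _ = _ := by
        rw [← lintegral_const_mul _ (by fun_prop)]
        refine lintegral_congr fun y => ?_
        simp only [Real.exp_add, ENNReal.ofReal_mul (Real.exp_pos _).le]
        rw [lintegral_mul_const _ hSm.exp.ennreal_ofReal, ofReal_integral_eq_lintegral_ofReal hint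
          (ae_of_all _ fun _ => (Real.exp_pos _).le)]

lemma campbellMeasure_shotNoise (hY : IsPPP Pr Λ N Y) {u : E → ℝ}
    (hu : Measurable u) (hu0 : ∀ y, 0 ≤ u y) :
    campbellMeasure Pr N Y (fun ω => shotNoise u (N ω) fun i => Y i ω) =
      (Λ.prod Pr).map fun p => (p.1, (shotNoise u (N p.2) fun i => Y i p.2) + u p.1) := by
  have := hY.isFiniteMeasure_intensity
  have := hY.isProbabilityMeasure
  have hS := hY.measurable_shotNoise hu
  have hmap := hY.measurable_prodMk_shotNoise_add hu
  have := hY.isFiniteMeasure_campbellMeasure hS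
  have hnonneg : MeasurableSet {p : E × ℝ | 0 ≤ p.2} := measurable_snd measurableSet_Ici
  refine measure_prod_ext_of_laplace ?_ ?_ fun B hB k => ?_
  · rw [campbellMeasure, Measure.ae_sum_iff]
    exact fun i => (ae_map_iff ((hY.measurable_point i).prodMk hS).aemeasurable hnonneg).2
      (ae_of_all _ fun ω => shotNoise_nonneg hu0 _ _)
  · exact (ae_map_iff hmap.aemeasurable hnonneg).2
      (ae_of_all _ fun p => add_nonneg (shotNoise_nonneg hu0 _ _) (hu0 _))
  have hexp : Measurable fun p : E × ℝ => ENNReal.ofReal (Real.exp (-(k * p.2))) := by fun_prop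
  have hmecke := hY.lintegral_sum_indicator_exp_shotNoise (hu.const_mul (-k : ℝ))
    (fun y => mul_nonpos_of_nonpos_of_nonneg (by simp) (hu0 y)) hB
  simp only [← mul_shotNoise, ← mul_add] at hmecke
  simp only [neg_mul] at hmecke
  calc _ = ∫⁻ ω, ∑ i ∈ Finset.range (N ω), B.indicator (fun _ => ENNReal.ofReal
          (Real.exp (-(k * shotNoise u (N ω) fun i => Y i ω)))) (Y i ω) ∂Pr := by
        rw [← lintegral_indicator (measurable_fst hB),
          hY.lintegral_campbellMeasure hS (hexp.indicator (measurable_fst hB))]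
        rfl
    _ = _ := hmecke
    _ = _ := by
        have hrestrict : (Λ.prod Pr).restrict (Prod.fst ⁻¹' B) = (Λ.restrict B).prod Pr := by
          rw [← Set.prod_univ, ← Measure.prod_restrict, Measure.restrict_univ]
        rw [setLIntegral_map (measurable_fst hB) hexp hmap]
        change _ = ∫⁻ p in Prod.fst ⁻¹' B, _ ∂Λ.prod Pr
        rw [hrestrict]
        exact (lintegral_prod _ (hexp.comp hmap).aemeasurable).symm

/-- The Slivnyak–Mecke formula for a shot noise. -/
theorem lintegral_sum_sub_shotNoise (hY : IsPPP Pr Λ N Y) {u : E → ℝ}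
    (hu : Measurable u) (hu0 : ∀ y, 0 ≤ u y) {f : E × ℝ → ℝ≥0∞} (hf : Measurable f) :
    ∫⁻ ω, ∑ i ∈ Finset.range (N ω),
        f (Y i ω, (shotNoise u (N ω) fun j => Y j ω) - u (Y i ω)) ∂Pr =
      ∫⁻ y, ∫⁻ ω, f (y, shotNoise u (N ω) fun j => Y j ω) ∂Pr ∂Λ := by
  have := hY.isProbabilityMeasure
  have hS := hY.measurable_shotNoise hu
  have hf' : Measurable fun p : E × ℝ => f (p.1, p.2 - u p.1) := by fun_prop
  have hmap := hY.measurable_prodMk_shotNoise_add hu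
  rw [← hY.lintegral_campbellMeasure hS hf', hY.campbellMeasure_shotNoise hu hu0,
    lintegral_map hf' hmap]
  simp only [add_sub_cancel_right]
  exact lintegral_prod _
    (hf.comp (measurable_fst.prodMk (hS.comp measurable_snd))).aemeasurable

theorem marked (hY : IsPPP Pr Λ N Y) {κ : Measure F} {τ : ℕ → Ω → F}
    (hτ : ∀ i, Measurable (τ i)) (hind : iIndepFun τ Pr) (hlaw : ∀ i, Pr.map (τ i) = κ)
    (hindY : IndepFun (fun ω => (N ω, fun i => Y i ω)) (fun ω i => τ i ω) Pr) :
    IsPPP Pr (Λ.prod κ) N fun i ω => (Y i ω, τ i ω) := by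
  have := hY.isFiniteMeasure_intensity
  have := hY.isProbabilityMeasure
  have : IsProbabilityMeasure κ := hlaw 0 ▸ Measure.isProbabilityMeasure_map (hτ 0).aemeasurable
  refine ⟨inferInstance, hY.measurable_number, fun i => (hY.measurable_point i).prodMk (hτ i),
    fun {w M} hw hw' => ?_⟩
  have hw_fst (x : E) : Measurable fun t => w (x, t) := hw.comp measurable_prodMk_left
  have hmean : Measurable fun x => ∫ t, w (x, t) ∂κ :=
    hw.stronglyMeasurable.integral_prod_right'.measurable
  have hmean_mem (x : E) : ∫ t, w (x, t) ∂κ ∈ Set.Icc 0 M :=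
    ⟨integral_nonneg fun t => (hw' _).1, by
      simpa using integral_mono (μ := κ) (integrable_of_mem_Icc (hw_fst x) fun t => hw' _)
        (integrable_const M) fun t => (hw' (x, t)).2⟩
  have hmeas : Measurable fun p : (ℕ × (ℕ → E)) × (ℕ → F) =>
      ∏ i ∈ Finset.range p.1.1, ENNReal.ofReal (w (p.1.2 i, p.2 i)) :=
    measurable_apply_nat (N := fun p : (ℕ × (ℕ → E)) × (ℕ → F) => p.1.1)
      (f := fun n p => ∏ i ∈ Finset.range n, ENNReal.ofReal (w (p.1.2 i, p.2 i)))
      (by fun_prop) fun n => by fun_prop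
  have hint : Integrable (fun p => w p - 1) (Λ.prod κ) :=
    (integrable_of_mem_Icc hw hw').sub (integrable_const 1)
  calc _ = ∫⁻ ω, ∫⁻ ω', ∏ i ∈ Finset.range (N ω),
          ENNReal.ofReal (w (Y i ω, τ i ω')) ∂Pr ∂Pr :=
        lintegral_comp_prodMk_of_indepFun
          (hY.measurable_number.prodMk (measurable_pi_lambda _ hY.measurable_point))
          (measurable_pi_lambda _ hτ) hindY hmeas
    _ = ∫⁻ ω, ∏ i ∈ Finset.range (N ω), ENNReal.ofReal (∫ t, w (Y i ω, t) ∂κ) ∂Pr := by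
        refine lintegral_congr fun ω => ?_
        rw [lintegral_prod_marks hτ hind hlaw fun i => (hw_fst (Y i ω)).ennreal_ofReal]
        refine Finset.prod_congr rfl fun i _ => ?_
        rw [ofReal_integral_eq_lintegral_ofReal (integrable_of_mem_Icc (hw_fst _) fun t => hw' _)
          (ae_of_all _ fun t => (hw' _).1)]
    _ = _ := by
        rw [hY.lintegral_prod_ofReal hmean hmean_mem, integral_prod _ hint]
        congr! 4 with x
        simp [integral_sub (integrable_of_mem_Icc (hw_fst x) fun _ => hw' _)
          (integrable_const 1)]

end IsPPP

end PPP

section HomogeneousPPP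

lemma lintegral_pow_poissonMeasure (r : NNReal) {z : ℝ} (hz : 0 ≤ z) :
    ∫⁻ k, ENNReal.ofReal (z ^ k) ∂poissonMeasure r =
      ENNReal.ofReal (Real.exp (r * (z - 1))) := by
  have h : HasSum (fun k : ℕ => z ^ k * (Real.exp (-r) * r ^ k / k.factorial))
      (Real.exp (r * (z - 1))) := by
    have h' := (NormedSpace.expSeries_div_hasSum_exp ((r : ℝ) * z)).mul_left (Real.exp (-r))
    rw [← Real.exp_eq_exp_ℝ, ← Real.exp_add, neg_add_eq_sub, ← mul_sub_one] at h'
    exact h'.congr_fun fun k => by rw [mul_pow]; ring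
  rw [lintegral_countable', ← h.tsum_eq, ENNReal.ofReal_tsum_of_nonneg
    (fun k => by positivity) h.summable]
  simp only [poissonMeasure_singleton, ENNReal.ofReal_mul (pow_nonneg hz _)]

lemma integral_simpleFunc_sub_one {E : Type*} [MeasurableSpace E] (μ : Measure E)
    [IsFiniteMeasure μ] (w : SimpleFunc E ℝ) :
    ∫ x, (w x - 1) ∂μ = ∑ v ∈ w.range, μ.real (w ⁻¹' {v}) * (v - 1) := by
  have huniv : μ.real Set.univ = ∑ v ∈ w.range, μ.real (w ⁻¹' {v}) := by
    rw [sum_measureReal_preimage_singleton _ fun v _ => w.measurableSet_preimage _,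
      w.coe_range, Set.preimage_range]
  have hw : Integrable w μ := w.integrable_of_isFiniteMeasure
  rw [integral_sub hw (integrable_const _), ← w.integral_eq_integral hw, w.integral_eq,
    integral_const, huniv, smul_eq_mul, mul_one, ← Finset.sum_sub_distrib]
  simp only [smul_eq_mul, mul_sub, mul_one]

lemma countIn_univ (n : ℕ) (x : ℕ → Plane) : countIn n x Set.univ = n := by
  simp [countIn]

lemma prod_range_eq_prod_pow_countIn {M : Type*} [CommMonoid M] (g : ℝ → M)
    (w : SimpleFunc Plane ℝ) (n : ℕ) (x : ℕ → Plane) :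
    ∏ i ∈ Finset.range n, g (w (x i)) = ∏ v ∈ w.range, g v ^ countIn n x (w ⁻¹' {v}) := by
  classical
  rw [← Finset.prod_fiberwise_of_maps_to' (t := w.range) fun i _ => w.mem_range_self (x i)]
  simp only [Finset.prod_const, countIn, Set.mem_preimage, Set.mem_singleton_iff]

namespace IsHomogeneousPPP

variable {Ω : Type*} [MeasurableSpace Ω] {Pr : Measure Ω} {lam : ℝ} {𝒜 : Set Plane}
  {N : Ω → ℕ} {X : ℕ → Ω → Plane}

lemma measurable_countIn (h : IsHomogeneousPPP Pr lam 𝒜 N X) {B : Set Plane}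
    (hB : MeasurableSet B) : Measurable fun ω => countIn (N ω) (fun i => X i ω) B := by
  classical
  refine measurable_apply_nat h.measurable_number
    (f := fun n ω => countIn n (fun i => X i ω) B) fun n => ?_
  simp only [countIn, Finset.card_filter]
  exact Finset.measurable_fun_sum _ fun i _ =>
    Measurable.ite (h.measurable_position i hB) measurable_const measurable_const

lemma measurable_prod_weight (h : IsHomogeneousPPP Pr lam 𝒜 N X) {w : Plane → ℝ≥0∞}
    (hw : Measurable w) : Measurable fun ω => ∏ i ∈ Finset.range (N ω), w (X i ω) :=
  measurable_apply_nat h.measurable_number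
    (f := fun n ω => ∏ i ∈ Finset.range n, w (X i ω))
    fun _ => Finset.measurable_fun_prod _ fun i _ => hw.comp (h.measurable_position i)

lemma iIndepFun_countIn_preimage (h : IsHomogeneousPPP Pr lam 𝒜 N X) (w : SimpleFunc Plane ℝ) :
    iIndepFun (fun (v : w.range) ω => countIn (N ω) (fun i => X i ω) (w ⁻¹' {(v : ℝ)})) Pr := by
  have hdisj : Pairwise fun j l => Disjoint (w ⁻¹' {(w.range.equivFin.symm j : ℝ)})
      (w ⁻¹' {(w.range.equivFin.symm l : ℝ)}) := fun j l hjl =>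
    .preimage _ (Set.disjoint_singleton.2 fun hv =>
      hjl (w.range.equivFin.symm.injective (Subtype.ext hv)))
  simpa using (h.count_indep _ _ (fun j => w.measurableSet_preimage _) hdisj).precomp
    w.range.equivFin.injective

lemma lintegral_pow_countIn (h : IsHomogeneousPPP Pr lam 𝒜 N X) (hlam : 0 ≤ lam) {B : Set Plane}
    (hB : MeasurableSet B) {z : ℝ} (hz : 0 ≤ z) :
    ∫⁻ ω, ENNReal.ofReal (z ^ countIn (N ω) (fun i => X i ω) B) ∂Pr =
      ENNReal.ofReal
        (Real.exp ((ENNReal.ofReal lam • volume.restrict 𝒜).real B * (z - 1))) := by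
  rw [← lintegral_map (f := fun k : ℕ => ENNReal.ofReal (z ^ k)) (measurable_of_countable _)
    (h.measurable_countIn hB), h.count_law B hB, lintegral_pow_poissonMeasure _ hz,
    Real.coe_toNNReal _ (by positivity), measureReal_ennreal_smul_apply,
    measureReal_restrict_apply hB, ENNReal.toReal_ofReal hlam]

lemma lintegral_prod_simpleFunc (h : IsHomogeneousPPP Pr lam 𝒜 N X) (hlam : 0 ≤ lam)
    (h𝒜 : volume 𝒜 ≠ ⊤) (w : SimpleFunc Plane ℝ) (hw : ∀ x, 0 ≤ w x) :
    ∫⁻ ω, ∏ i ∈ Finset.range (N ω), ENNReal.ofReal (w (X i ω)) ∂Pr =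
      ENNReal.ofReal
        (Real.exp (∫ x, (w x - 1) ∂(ENNReal.ofReal lam • volume.restrict 𝒜))) := by
  have := isFiniteMeasure_restrict.2 h𝒜
  have := (volume.restrict 𝒜).smul_finite (c := ENNReal.ofReal lam) ENNReal.ofReal_ne_top
  have hrange (v : w.range) : 0 ≤ (v : ℝ) := by
    obtain ⟨x, hx⟩ := SimpleFunc.mem_range.1 v.2
    exact hx ▸ hw x
  have hind := (h.iIndepFun_countIn_preimage w).comp
    (fun v k => ENNReal.ofReal ((v : ℝ) ^ k)) fun v => measurable_of_countable _
  calc _ = ∫⁻ ω, ∏ v : w.range,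
          ENNReal.ofReal ((v : ℝ) ^ countIn (N ω) (fun i => X i ω) (w ⁻¹' {(v : ℝ)})) ∂Pr := by
        refine lintegral_congr fun ω => ?_
        rw [prod_range_eq_prod_pow_countIn, ← Finset.prod_coe_sort]
        exact Finset.prod_congr rfl fun v _ => (ENNReal.ofReal_pow (hrange v) _).symm
    _ = ∏ v : w.range, ENNReal.ofReal (Real.exp
          ((ENNReal.ofReal lam • volume.restrict 𝒜).real (w ⁻¹' {(v : ℝ)}) * (v - 1))) := by
        refine (lintegral_prod_eq_prod_lintegral_of_indepFun Finset.univ _ hind fun v =>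
          (measurable_of_countable _).comp
            (h.measurable_countIn (w.measurableSet_preimage _))).trans ?_
        exact Finset.prod_congr rfl fun v _ =>
          h.lintegral_pow_countIn hlam (w.measurableSet_preimage _) (hrange v)
    _ = _ := by
        rw [← ENNReal.ofReal_prod_of_nonneg fun _ _ => (Real.exp_pos _).le, ← Real.exp_sum,
          integral_simpleFunc_sub_one, ← Finset.sum_coe_sort w.range]

lemma lintegral_pow_number_ne_top (h : IsHomogeneousPPP Pr lam 𝒜 N X) (hlam : 0 ≤ lam) {z : ℝ}
    (hz : 0 ≤ z) : ∫⁻ ω, ENNReal.ofReal (z ^ N ω) ∂Pr ≠ ⊤ := by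
  simpa only [countIn_univ] using
    (h.lintegral_pow_countIn hlam .univ hz).trans_ne ENNReal.ofReal_ne_top

theorem isPPP (h : IsHomogeneousPPP Pr lam 𝒜 N X) (hlam : 0 ≤ lam)
    (h𝒜 : volume 𝒜 ≠ ⊤) :
    IsPPP Pr (ENNReal.ofReal lam • volume.restrict 𝒜) N X := by
  have := isFiniteMeasure_restrict.2 h𝒜
  have hΛ := (volume.restrict 𝒜).smul_finite (c := ENNReal.ofReal lam) ENNReal.ofReal_ne_top
  refine ⟨hΛ, h.measurable_number, h.measurable_position, fun {w M} hw hw' => ?_⟩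
  have hM : 0 ≤ M := (hw' 0).1.trans (hw' 0).2
  set f : ℕ → SimpleFunc Plane ℝ := SimpleFunc.approxOn w hw (Set.Icc 0 M) 0 ⟨le_rfl, hM⟩
  have hf (k : ℕ) (x : Plane) : f k x ∈ Set.Icc 0 M := SimpleFunc.approxOn_mem hw _ k x
  have hlim (x : Plane) : Tendsto (fun k => f k x) atTop (𝓝 (w x)) :=
    SimpleFunc.tendsto_approxOn hw _ (subset_closure (hw' x))
  have hleft : Tendsto
      (fun k => ∫⁻ ω, ∏ i ∈ Finset.range (N ω), ENNReal.ofReal (f k (X i ω)) ∂Pr) atTop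
      (𝓝 (∫⁻ ω, ∏ i ∈ Finset.range (N ω), ENNReal.ofReal (w (X i ω)) ∂Pr)) := by
    simp only [← ENNReal.ofReal_prod_of_nonneg fun _ _ => (hf _ _).1,
      ← ENNReal.ofReal_prod_of_nonneg fun _ _ => (hw' _).1]
    refine tendsto_lintegral_of_dominated_convergence (fun ω => ENNReal.ofReal (M ^ N ω))
      (fun k => ?_) (fun k => ae_of_all _ fun ω => ENNReal.ofReal_le_ofReal ?_)
      (h.lintegral_pow_number_ne_top hlam hM) (ae_of_all _ fun ω =>
        ENNReal.tendsto_ofReal (tendsto_finsetProd _ fun i _ => hlim _))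
    · simpa only [ENNReal.ofReal_prod_of_nonneg fun _ _ => (hf _ _).1] using
        h.measurable_prod_weight (f k).measurable.ennreal_ofReal
    · simpa using Finset.prod_le_prod (s := Finset.range (N ω)) (fun i _ => (hf k _).1)
        fun i _ => (hf k (X i ω)).2
  have hright : Tendsto
      (fun k => ∫ x, (f k x - 1) ∂(ENNReal.ofReal lam • volume.restrict 𝒜)) atTop
      (𝓝 (∫ x, (w x - 1) ∂(ENNReal.ofReal lam • volume.restrict 𝒜))) := by
    refine tendsto_integral_of_dominated_convergence (fun _ => M + 1)
      (fun k => ((f k).measurable.sub_const 1).aestronglyMeasurable) (integrable_const _)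
      (fun k => ae_of_all _ fun x => ?_) (ae_of_all _ fun x => (hlim x).sub_const 1)
    rw [Real.norm_eq_abs, abs_le]
    constructor <;> linarith [(hf k x).1, (hf k x).2]
  refine tendsto_nhds_unique hleft ((ENNReal.tendsto_ofReal
    ((Real.continuous_exp.tendsto _).comp hright)).congr fun k => ?_)
  exact (h.lintegral_prod_simpleFunc hlam h𝒜 (f k) fun x => (hf k x).1).symm

end IsHomogeneousPPP

end HomogeneousPPP

section Polar

lemma le_cos_iff_abs_le_arccos {K φ : ℝ} (hK : K ≤ 1) (hφ : |φ| ≤ Real.pi) :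
    K ≤ Real.cos φ ↔ |φ| ≤ Real.arccos K := by
  rcases lt_or_ge K (-1) with hK' | hK'
  · rw [Real.arccos_of_le_neg_one hK'.le]
    exact iff_of_true (hK'.le.trans (Real.neg_one_le_cos φ)) hφ
  · rw [← Real.cos_abs φ]
    conv_lhs => rw [← Real.cos_arccos hK' hK]
    exact Real.strictAntiOn_cos.le_iff_ge ⟨Real.arccos_nonneg _, Real.arccos_le_pi K⟩
      ⟨abs_nonneg _, hφ⟩

lemma volume_setOf_le_cos (K : ℝ) :
    volume {φ ∈ Set.Ioo (-Real.pi) Real.pi | K ≤ Real.cos φ} =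
      ENNReal.ofReal (2 * Real.arccos K) := by
  rcases lt_or_ge 1 K with hK | hK
  · have hempty : {φ ∈ Set.Ioo (-Real.pi) Real.pi | K ≤ Real.cos φ} = ∅ :=
      Set.eq_empty_of_forall_notMem fun φ hφ => (hφ.2.trans (Real.cos_le_one φ)).not_gt hK
    rw [hempty, measure_empty, Real.arccos_of_one_le hK.le, mul_zero, ENNReal.ofReal_zero]
  have hα := Real.arccos_le_pi K
  have hiff {φ : ℝ} (hφ : φ ∈ Set.Ioo (-Real.pi) Real.pi) :=
    le_cos_iff_abs_le_arccos hK (abs_lt.2 hφ).le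
  refine le_antisymm ?_ ?_
  · calc _ ≤ volume (Set.Icc (-Real.arccos K) (Real.arccos K)) :=
          measure_mono fun φ hφ => abs_le.1 ((hiff hφ.1).1 hφ.2)
      _ = _ := by rw [Real.volume_Icc, sub_neg_eq_add, two_mul]
  · calc _ = volume (Set.Ioo (-Real.arccos K) (Real.arccos K)) := by
          rw [Real.volume_Ioo, sub_neg_eq_add, two_mul]
      _ ≤ _ := measure_mono fun φ hφ => by
          have hφ' : φ ∈ Set.Ioo (-Real.pi) Real.pi := ⟨by linarith [hφ.1], by linarith [hφ.2]⟩
          exact ⟨hφ', (hiff hφ').2 (abs_lt.2 hφ).le⟩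

lemma theta_eq_arccos {R Rmse w : ℝ} (hR : 0 < R) (hRmse : 0 < Rmse) (hw : 0 < w)
    (hwR : w ≤ R) :
    theta R Rmse w = 2 * Real.arccos ((R ^ 2 + w ^ 2 - Rmse ^ 2) / (2 * R * w)) := by
  have hden : 0 < 2 * R * w := by positivity
  unfold theta
  split_ifs with hinside hmeet
  · have hle : w ≤ Rmse - R := (le_max_iff.1 hinside.2).resolve_left hw.not_ge
    rw [Real.arccos_of_le_neg_one]
    rw [div_le_iff₀ hden]
    nlinarith
  · rfl
  · have hlt : w < |Rmse - R| := not_le.1 fun hle => hmeet ⟨hle, by linarith⟩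
    have hgt : Rmse - R < w := not_le.1 fun hle => hinside ⟨hw.le, le_max_of_le_right hle⟩
    have hdisjoint : w < R - Rmse := by
      rcases lt_abs.1 hlt with h | h <;> linarith
    rw [Real.arccos_of_one_le, mul_zero]
    rw [le_div_iff₀ hden]
    nlinarith

lemma norm_polarCoord_symm_sub_sq (w φ R : ℝ) :
    ‖Complex.polarCoord.symm (w, φ) - R‖ ^ 2 = w ^ 2 + R ^ 2 - 2 * R * w * Real.cos φ := by
  rw [Complex.polarCoord_symm_apply, ← Complex.normSq_eq_norm_sq, Complex.normSq_apply]
  simp only [Complex.sub_re, Complex.sub_im, Complex.mul_re, Complex.mul_im, Complex.add_re,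
    Complex.add_im, Complex.ofReal_re, Complex.ofReal_im, Complex.I_re, Complex.I_im]
  linear_combination w ^ 2 * Real.sin_sq_add_cos_sq φ

lemma norm_polarCoord_symm_sub_le_iff {w φ R ρ : ℝ} (hw : 0 < w) (hR : 0 < R) (hρ : 0 ≤ ρ) :
    ‖Complex.polarCoord.symm (w, φ) - R‖ ≤ ρ ↔
      (R ^ 2 + w ^ 2 - ρ ^ 2) / (2 * R * w) ≤ Real.cos φ := by
  rw [div_le_iff₀ (by positivity), ← sq_le_sq₀ (norm_nonneg _) hρ, norm_polarCoord_symm_sub_sq]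
  constructor <;> intro h <;> linarith

lemma measurable_polarCoord_symm : Measurable Complex.polarCoord.symm := by
  have h : (Complex.polarCoord.symm : ℝ × ℝ → ℂ) =
      fun p => p.1 * (Real.cos p.2 + Real.sin p.2 * Complex.I) :=
    funext Complex.polarCoord_symm_apply
  rw [h]
  fun_prop

lemma setLIntegral_comp_norm_complex {F : ℝ → ℝ≥0∞} (hF : Measurable F) {S : Set ℂ}
    (hS : MeasurableSet S) :
    ∫⁻ z in S, F ‖z‖ = ∫⁻ w in Set.Ioi 0, ENNReal.ofReal w * (F w *
      volume {φ ∈ Set.Ioo (-Real.pi) Real.pi | Complex.polarCoord.symm (w, φ) ∈ S}) := by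
  have hind : Measurable (S.indicator fun z => F ‖z‖) := (hF.comp measurable_norm).indicator hS
  have hmeas : Measurable fun p : ℝ × ℝ => ENNReal.ofReal p.1 •
      S.indicator (fun z => F ‖z‖) (Complex.polarCoord.symm p) :=
    measurable_fst.ennreal_ofReal.mul (hind.comp measurable_polarCoord_symm)
  rw [← lintegral_indicator hS, ← Complex.lintegral_comp_polarCoord_symm, polarCoord_target,
    Measure.volume_eq_prod, ← Measure.prod_restrict, lintegral_prod _ hmeas.aemeasurable]
  refine setLIntegral_congr_fun measurableSet_Ioi fun w (hw : 0 < w) => ?_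
  have hslice : MeasurableSet {φ | Complex.polarCoord.symm (w, φ) ∈ S} :=
    (measurable_polarCoord_symm.comp measurable_prodMk_left) hS
  have hfun (φ : ℝ) : ENNReal.ofReal w •
      S.indicator (fun z => F ‖z‖) (Complex.polarCoord.symm (w, φ)) =
      {φ | Complex.polarCoord.symm (w, φ) ∈ S}.indicator
        (fun _ => ENNReal.ofReal w * F w) φ := by
    by_cases hφ : Complex.polarCoord.symm (w, φ) ∈ S <;>
      simp [-Complex.polarCoord_symm_apply, hφ, Complex.norm_polarCoord_symm, abs_of_pos hw]
  simp only [hfun]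
  rw [lintegral_indicator_const hslice, Measure.restrict_apply hslice, Set.inter_comm, mul_assoc]
  rfl

lemma setLIntegral_lens_complex {R ρ : ℝ} (hR : 0 < R) (hρ : 0 < ρ) {F : ℝ → ℝ≥0∞}
    (hF : Measurable F) :
    ∫⁻ z in {z : ℂ | ‖z - R‖ ≤ ρ ∧ ‖z‖ ≤ R}, F ‖z‖ =
      ∫⁻ w in Set.Ioo 0 R, ENNReal.ofReal w * (F w * ENNReal.ofReal (theta R ρ w)) := by
  have hS : MeasurableSet {z : ℂ | ‖z - R‖ ≤ ρ ∧ ‖z‖ ≤ R} :=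
    (measurableSet_le (f := fun z : ℂ => ‖z - R‖) (by fun_prop) measurable_const).inter
      (measurableSet_le measurable_norm measurable_const)
  have hangle {w : ℝ} (hw : 0 < w) : volume {φ ∈ Set.Ioo (-Real.pi) Real.pi |
      Complex.polarCoord.symm (w, φ) ∈ {z : ℂ | ‖z - R‖ ≤ ρ ∧ ‖z‖ ≤ R}} =
      (Set.Iic R).indicator (fun w => ENNReal.ofReal (theta R ρ w)) w := by
    simp only [Set.mem_ofPred_eq, Complex.norm_polarCoord_symm, abs_of_pos hw,
      norm_polarCoord_symm_sub_le_iff hw hR hρ.le]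
    by_cases hwR : w ≤ R
    · simp only [hwR, and_true]
      rw [volume_setOf_le_cos, Set.indicator_of_mem (Set.mem_Iic.2 hwR),
        theta_eq_arccos hR hρ hw hwR]
    · simp [hwR]
  calc _ = ∫⁻ w in Set.Ioi 0, (Set.Iic R).indicator
          (fun w => ENNReal.ofReal w * (F w * ENNReal.ofReal (theta R ρ w))) w := by
        rw [setLIntegral_comp_norm_complex hF hS]
        refine setLIntegral_congr_fun measurableSet_Ioi fun w hw => ?_
        simp only [hangle hw, Set.indicator_mul_right]
    _ = _ := by
        rw [setLIntegral_indicator measurableSet_Iic, Set.inter_comm, Set.Ioi_inter_Iic,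
          setLIntegral_congr Ioo_ae_eq_Ioc.symm]

lemma image_sqrt_sq_add_sq {h R : ℝ} (hh : 0 < h) (hR : 0 < R) :
    (fun w => √(w ^ 2 + h ^ 2)) '' Set.Ioo 0 R = Set.Ioo h (√(h ^ 2 + R ^ 2)) := by
  ext r
  constructor
  · rintro ⟨w, hw, rfl⟩
    exact ⟨Real.lt_sqrt_of_sq_lt (by nlinarith [hw.1]),
      Real.sqrt_lt_sqrt (by positivity) (by nlinarith [hw.1, hw.2])⟩
  · rintro ⟨hhr, hrd⟩
    have hr : 0 < r := hh.trans hhr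
    have hrR : r ^ 2 < h ^ 2 + R ^ 2 := (Real.lt_sqrt hr.le).1 hrd
    have hpos : 0 < r ^ 2 - h ^ 2 := by nlinarith
    refine ⟨√(r ^ 2 - h ^ 2), ⟨Real.sqrt_pos.2 hpos, ?_⟩, ?_⟩
    · rw [Real.sqrt_lt' hR]
      linarith
    · simp only [Real.sq_sqrt hpos.le, sub_add_cancel, Real.sqrt_sq hr.le]

lemma setLIntegral_comp_sqrt_sq_add_sq {h R : ℝ} (hh : 0 < h) (hR : 0 < R) (F Θ : ℝ → ℝ≥0∞) :
    ∫⁻ w in Set.Ioo 0 R, ENNReal.ofReal w * (F (√(w ^ 2 + h ^ 2)) * Θ w) =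
      ∫⁻ r in Set.Ioo h (√(h ^ 2 + R ^ 2)),
        ENNReal.ofReal r * (F r * Θ (√(r ^ 2 - h ^ 2))) := by
  have hpos (w : ℝ) : 0 < w ^ 2 + h ^ 2 := by positivity
  have hderiv (w : ℝ) (_ : w ∈ Set.Ioo 0 R) : HasDerivWithinAt (fun w => √(w ^ 2 + h ^ 2))
      (w / √(w ^ 2 + h ^ 2)) (Set.Ioo 0 R) w := by
    have hd := ((hasDerivAt_pow 2 w).add_const (h ^ 2)).sqrt (hpos w).ne'
    refine (hd.congr_deriv ?_).hasDerivWithinAt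
    have := Real.sqrt_pos.2 (hpos w)
    field_simp
    simp
  have hinj : Set.InjOn (fun w => √(w ^ 2 + h ^ 2)) (Set.Ioo 0 R) := fun w hw w' hw' heq =>
    (pow_left_inj₀ hw.1.le hw'.1.le two_ne_zero).1
      (by linarith [(Real.sqrt_inj (hpos w).le (hpos w').le).1 heq])
  rw [← image_sqrt_sq_add_sq hh hR,
    lintegral_image_eq_lintegral_abs_deriv_mul measurableSet_Ioo hderiv hinj]
  refine setLIntegral_congr_fun measurableSet_Ioo fun w hw => ?_
  have hw0 : 0 < w := hw.1
  have hs := Real.sqrt_pos.2 (hpos w)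
  rw [Real.sq_sqrt (hpos w).le, add_sub_cancel_right, Real.sqrt_sq hw0.le, ← mul_assoc,
    ← mul_assoc, ← mul_assoc, ← ENNReal.ofReal_mul (abs_nonneg _), abs_of_pos (by positivity),
    div_mul_cancel₀ _ hs.ne']

lemma exists_linearIsometryEquiv_complex (v : Plane) :
    ∃ U : Plane ≃ₗᵢ[ℝ] ℂ, U v = (‖v‖ : ℂ) := by
  set U₀ : Plane ≃ₗᵢ[ℝ] ℂ := Complex.orthonormalBasisOneI.repr.symm
  refine ⟨U₀.trans (rotation (Circle.exp (-(U₀ v).arg))), ?_⟩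
  have hpolar := Complex.norm_mul_exp_arg_mul_I (U₀ v)
  rw [U₀.norm_map v] at hpolar
  rw [LinearIsometryEquiv.trans_apply, rotation_apply, Circle.coe_exp]
  calc Complex.exp (((-(U₀ v).arg : ℝ) : ℂ) * Complex.I) * U₀ v
      = Complex.exp (((-(U₀ v).arg : ℝ) : ℂ) * Complex.I) *
          (‖v‖ * Complex.exp ((U₀ v).arg * Complex.I)) := by rw [hpolar]
    _ = ‖v‖ := by
      rw [mul_left_comm, ← Complex.exp_add]
      simp

theorem setLIntegral_lens {h R ρ : ℝ} (hh : 0 < h) (hR : 0 < R) (hρ : 0 < ρ) {c e : Plane}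
    (he : dist e c = R) {F : ℝ → ℝ≥0∞} (hF : Measurable F) :
    ∫⁻ x in Metric.closedBall e ρ ∩ Metric.closedBall c R, F (droneDist c h x) =
      ∫⁻ r in Set.Ioo h (√(h ^ 2 + R ^ 2)),
        ENNReal.ofReal r * (F r * ENNReal.ofReal (theta R ρ (√(r ^ 2 - h ^ 2)))) := by
  obtain ⟨U, hU⟩ := exists_linearIsometryEquiv_complex (e - c)
  rw [← dist_eq_norm, he] at hU
  have hmp : MeasurePreserving (fun x : Plane => U (x - c)) volume volume :=
    U.measurePreserving.comp (measurePreserving_sub_right volume c)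
  have hemb : MeasurableEmbedding (fun x : Plane => U (x - c)) :=
    U.toHomeomorph.measurableEmbedding.comp (Homeomorph.subRight c).measurableEmbedding
  have hnorm (x : Plane) : ‖U (x - c)‖ = dist x c := by rw [U.norm_map, dist_eq_norm]
  have hnorm' (x : Plane) : ‖U (x - c) - R‖ = dist x e := by
    rw [← hU, ← map_sub, U.norm_map, dist_eq_norm, sub_sub_sub_cancel_right]
  have hset : Metric.closedBall e ρ ∩ Metric.closedBall c R =
      (fun x : Plane => U (x - c)) ⁻¹' {z : ℂ | ‖z - R‖ ≤ ρ ∧ ‖z‖ ≤ R} := by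
    ext x
    simp only [Set.mem_preimage, Set.mem_ofPred_eq, hnorm, hnorm', Set.mem_inter_iff,
      Metric.mem_closedBall]
  simp only [droneDist, ← hnorm]
  rw [hset, hmp.setLIntegral_comp_preimage_emb hemb fun z : ℂ => F (√(‖z‖ ^ 2 + h ^ 2)),
    setLIntegral_lens_complex hR hρ (F := fun w => F (√(w ^ 2 + h ^ 2))) (hF.comp (by fun_prop)),
    setLIntegral_comp_sqrt_sq_add_sq hh hR F fun w => ENNReal.ofReal (theta R ρ w)]

lemma setLIntegral_disk {h R : ℝ} (hh : 0 < h) (hR : 0 < R) (c : Plane) {F : ℝ → ℝ≥0∞}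
    (hF : Measurable F) :
    ∫⁻ x in Metric.closedBall c R, F (droneDist c h x) =
      ∫⁻ r in Set.Ioo h (√(h ^ 2 + R ^ 2)),
        ENNReal.ofReal r * (F r * ENNReal.ofReal (2 * Real.pi)) := by
  obtain ⟨e, he : dist e c = R⟩ := (NormedSpace.sphere_nonempty (x := c)).2 hR.le
  have hsub : Metric.closedBall c R ⊆ Metric.closedBall e (2 * R) :=
    Metric.closedBall_subset_closedBall' (by rw [dist_comm, he]; linarith)
  rw [← Set.inter_eq_right.2 hsub, setLIntegral_lens hh hR (by positivity) he hF]
  refine setLIntegral_congr_fun measurableSet_Ioo fun r hr => ?_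
  have hle : √(r ^ 2 - h ^ 2) ≤ R := by
    rw [Real.sqrt_le_left hR.le]
    linarith [(Real.lt_sqrt (hh.trans hr.1).le).1 hr.2]
  simp only [theta]
  rw [if_pos ⟨Real.sqrt_nonneg _, le_max_of_le_right (by linarith)⟩]

lemma measurable_theta (R Rmse : ℝ) : Measurable (theta R Rmse) := by
  unfold theta
  refine Measurable.ite ?_ measurable_const (Measurable.ite ?_ ?_ measurable_const)
  · exact measurableSet_Icc (a := (0 : ℝ)) (b := max 0 (Rmse - R))
  · exact measurableSet_Icc (a := |Rmse - R|) (b := Rmse + R)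
  · exact measurable_const.mul (Real.measurable_arccos.comp (by fun_prop))

lemma theta_nonneg (R Rmse w : ℝ) : 0 ≤ theta R Rmse w := by
  unfold theta
  split_ifs
  · positivity
  · exact mul_nonneg zero_le_two (Real.arccos_nonneg _)
  · exact le_rfl

lemma toReal_setLIntegral_ofReal_mul {h d : ℝ} (hh : 0 ≤ h) (hhd : h ≤ d) {f Θ : ℝ → ℝ}
    (hf : Measurable f) (hf0 : ∀ r, 0 < r → 0 ≤ f r) (hΘ : Measurable Θ) (hΘ0 : ∀ r, 0 ≤ Θ r) :
    (∫⁻ r in Set.Ioo h d, ENNReal.ofReal r *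
        (ENNReal.ofReal (f r) * ENNReal.ofReal (Θ r))).toReal =
      ∫ r in h..d, f r * r * Θ r := by
  have hpos {r : ℝ} (hr : r ∈ Set.Ioo h d) : 0 < r := hh.trans_lt hr.1
  rw [intervalIntegral.integral_of_le hhd, integral_Ioc_eq_integral_Ioo,
    integral_eq_lintegral_of_nonneg_ae _ (by fun_prop)]
  · congr 1
    refine setLIntegral_congr_fun measurableSet_Ioo fun r hr => ?_
    have hfr := hf0 r (hpos hr)
    rw [mul_comm (f r), ENNReal.ofReal_mul (mul_nonneg (hpos hr).le hfr),
      ENNReal.ofReal_mul (hpos hr).le, mul_assoc]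
  · filter_upwards [self_mem_ae_restrict measurableSet_Ioo] with r hr
    exact mul_nonneg (mul_nonneg (hf0 r (hpos hr)) (hpos hr).le) (hΘ0 r)

theorem toReal_setLIntegral_lens {h R ρ : ℝ} (hh : 0 < h) (hR : 0 < R) (hρ : 0 < ρ)
    {c e : Plane} (he : dist e c = R) {f : ℝ → ℝ} (hf : Measurable f)
    (hf0 : ∀ r, 0 < r → 0 ≤ f r) :
    (∫⁻ x in Metric.closedBall e ρ ∩ Metric.closedBall c R,
        ENNReal.ofReal (f (droneDist c h x))).toReal =
      ∫ r in h..√(h ^ 2 + R ^ 2), f r * r * theta R ρ (√(r ^ 2 - h ^ 2)) := by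
  rw [setLIntegral_lens hh hR hρ he hf.ennreal_ofReal]
  exact toReal_setLIntegral_ofReal_mul hh.le (Real.le_sqrt_of_sq_le (by nlinarith)) hf hf0
    ((measurable_theta R ρ).comp (by fun_prop)) fun r => theta_nonneg R ρ _

lemma toReal_setLIntegral_disk {h R : ℝ} (hh : 0 < h) (hR : 0 < R) (c : Plane) {f : ℝ → ℝ}
    (hf : Measurable f) (hf0 : ∀ r, 0 < r → 0 ≤ f r) :
    (∫⁻ x in Metric.closedBall c R, ENNReal.ofReal (f (droneDist c h x))).toReal =
      2 * Real.pi * ∫ r in h..√(h ^ 2 + R ^ 2), f r * r := by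
  rw [setLIntegral_disk hh hR c hf.ennreal_ofReal,
    toReal_setLIntegral_ofReal_mul hh.le (Real.le_sqrt_of_sq_le (by nlinarith)) hf hf0
      measurable_const fun _ => by positivity, intervalIntegral.integral_mul_const, mul_comm]

end Polar

section Gamma

lemma gammaPDF_mul_exp {m : ℕ} (hm : 1 ≤ m) {t : ℝ} (ht : 0 ≤ t) (g : ℝ) :
    gammaPDF m m g * ENNReal.ofReal (Real.exp (-t * g)) =
      ENNReal.ofReal ((1 + t / m) ^ (-(m : ℤ))) * gammaPDF m (m + t) g := by
  have hm0 : (0 : ℝ) < m := by exact_mod_cast hm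
  have : (0 : ℝ) < m + t := by positivity
  rw [gammaPDF, gammaPDF, ← ENNReal.ofReal_mul (gammaPDFReal_nonneg hm0 hm0 g),
    ← ENNReal.ofReal_mul (by positivity)]
  congr 1
  unfold gammaPDFReal
  split_ifs
  · have hexp : Real.exp (-((m + t) * g)) = Real.exp (-(m * g)) * Real.exp (-t * g) := by
      rw [← Real.exp_add]
      ring_nf
    have hbase : (1 + t / m : ℝ) = (m + t) / m := by field_simp
    rw [hexp, hbase, zpow_neg, zpow_natCast, Real.rpow_natCast, Real.rpow_natCast, div_pow]
    field_simp
  · simp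

lemma lintegral_exp_neg_mul_gammaMeasure {m : ℕ} (hm : 1 ≤ m) {t : ℝ} (ht : 0 ≤ t) :
    ∫⁻ g, ENNReal.ofReal (Real.exp (-t * g)) ∂(gammaMeasure m m) =
      ENNReal.ofReal ((1 + t / m) ^ (-(m : ℤ))) := by
  have hm0 : (0 : ℝ) < m := by exact_mod_cast hm
  have hmeas (r : ℝ) : Measurable (gammaPDF m r) := (measurable_gammaPDFReal _ _).ennreal_ofReal
  rw [gammaMeasure, lintegral_withDensity_eq_lintegral_mul _ (hmeas m) (by fun_prop)]
  simp only [Pi.mul_apply, gammaPDF_mul_exp hm ht]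
  rw [lintegral_const_mul _ (hmeas _), lintegral_gammaPDF_eq_one hm0 (by positivity), mul_one]

instance sFinite_gammaMeasure (a r : ℝ) : SFinite (gammaMeasure a r) :=
  inferInstanceAs (SFinite (volume.withDensity _))

lemma gammaMeasure_Iio_zero (a r : ℝ) : gammaMeasure a r (Set.Iio 0) = 0 := by
  rw [gammaMeasure, withDensity_apply _ measurableSet_Iio, lintegral_gammaPDF_of_nonpos le_rfl]

lemma ae_nonneg_gammaMeasure (a r : ℝ) : ∀ᵐ g ∂(gammaMeasure a r), 0 ≤ g := by
  rw [ae_iff]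
  simp only [not_le]
  exact gammaMeasure_Iio_zero a r

lemma lintegral_one_sub_exp_neg_mul_abs_gammaMeasure {m : ℕ} (hm : 1 ≤ m) {t : ℝ} (ht : 0 ≤ t) :
    ∫⁻ g, ENNReal.ofReal (1 - Real.exp (-t * |g|)) ∂gammaMeasure m m =
      ENNReal.ofReal (1 - (1 + t / m) ^ (-(m : ℤ))) := by
  have hm0 : (0 : ℝ) < m := by exact_mod_cast hm
  have := isProbabilityMeasure_gammaMeasure hm0 hm0
  have hle : ∀ᵐ g ∂gammaMeasure m m, ENNReal.ofReal (Real.exp (-t * g)) ≤ 1 := by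
    filter_upwards [ae_nonneg_gammaMeasure m m] with g hg
    simpa using mul_nonneg ht hg
  calc ∫⁻ g, ENNReal.ofReal (1 - Real.exp (-t * |g|)) ∂gammaMeasure m m
      = ∫⁻ g, (1 - ENNReal.ofReal (Real.exp (-t * g))) ∂gammaMeasure m m := by
        refine lintegral_congr_ae ?_
        filter_upwards [ae_nonneg_gammaMeasure m m] with g hg
        rw [abs_of_nonneg hg, ENNReal.ofReal_sub _ (Real.exp_pos _).le, ENNReal.ofReal_one]
    _ = 1 - ∫⁻ g, ENNReal.ofReal (Real.exp (-t * g)) ∂gammaMeasure m m := by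
        rw [lintegral_sub (by fun_prop)
          (by rw [lintegral_exp_neg_mul_gammaMeasure hm ht]; exact ENNReal.ofReal_ne_top) hle,
          lintegral_const, measure_univ, mul_one]
    _ = _ := by
        rw [lintegral_exp_neg_mul_gammaMeasure hm ht, ENNReal.ofReal_sub _ (by positivity),
          ENNReal.ofReal_one]

/-- The tail `t ↦ P(G ≥ t)` of the Gamma law of integer shape `m` and rate `m`: the event
`G ≥ t` says that a Poisson process of rate `m` has fewer than `m` points in `[0, t]`. -/
def gammaTail (m : ℕ) (t : ℝ) : ℝ :=
  ∑ k ∈ Finset.range m, (m * t) ^ k / (k.factorial : ℝ) * Real.exp (-(m * t))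

lemma measurable_gammaTail (m : ℕ) : Measurable (gammaTail m) := by
  unfold gammaTail
  fun_prop

lemma gammaTail_nonneg (m : ℕ) {t : ℝ} (ht : 0 ≤ t) : 0 ≤ gammaTail m t :=
  Finset.sum_nonneg fun k _ => by positivity

lemma hasDerivAt_sum_pow_div_factorial_mul_exp (n : ℕ) (x : ℝ) :
    HasDerivAt (fun x => ∑ k ∈ Finset.range (n + 1), x ^ k / (k.factorial : ℝ) * Real.exp (-x))
      (-(x ^ n / (n.factorial : ℝ) * Real.exp (-x))) x := by
  have hexp : HasDerivAt (fun x : ℝ => Real.exp (-x)) (-Real.exp (-x)) x := by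
    simpa using (hasDerivAt_neg x).exp
  induction n with
  | zero => simpa using hexp
  | succ n ih =>
    simp_rw [Finset.sum_range_succ _ (n + 1)]
    have hterm := ((hasDerivAt_pow (n + 1) x).div_const ((n + 1).factorial : ℝ)).mul hexp
    refine (ih.add hterm).congr_deriv ?_
    rw [Nat.factorial_succ]
    push_cast
    field_simp
    ring

lemma hasDerivAt_gammaTail {m : ℕ} (hm : 1 ≤ m) {x : ℝ} (hx : 0 ≤ x) :
    HasDerivAt (gammaTail m) (-gammaPDFReal m m x) x := by
  obtain ⟨n, rfl⟩ := Nat.exists_eq_add_of_le' hm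
  have hcomp := (hasDerivAt_sum_pow_div_factorial_mul_exp n (((n + 1 : ℕ) : ℝ) * x)).comp x
    ((hasDerivAt_id x).const_mul ((n + 1 : ℕ) : ℝ))
  refine hcomp.congr_deriv ?_
  have hΓ : Real.Gamma ((n + 1 : ℕ) : ℝ) = n.factorial := by
    rw [Nat.cast_add_one, Real.Gamma_nat_eq_factorial]
  rw [gammaPDFReal, if_pos hx, hΓ, Real.rpow_natCast, Nat.cast_add_one, add_sub_cancel_right,
    Real.rpow_natCast, pow_succ, mul_pow]
  ring

lemma tendsto_gammaTail_atTop (m : ℕ) : Tendsto (gammaTail m) atTop (𝓝 0) := by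
  unfold gammaTail
  rcases m.eq_zero_or_pos with rfl | hm
  · simp
  have hterm (k : ℕ) : Tendsto (fun x : ℝ => (m * x) ^ k / (k.factorial : ℝ) *
      Real.exp (-(m * x))) atTop (𝓝 0) := by
    have hlim := ((Real.tendsto_pow_mul_exp_neg_atTop_nhds_zero k).comp
      (tendsto_id.const_mul_atTop (Nat.cast_pos.2 hm))).const_mul (k.factorial : ℝ)⁻¹
    rw [mul_zero] at hlim
    refine hlim.congr fun x => ?_
    simp only [Function.comp_apply, id]
    ring
  simpa only [Finset.sum_const_zero] using tendsto_finsetSum (Finset.range m) fun k _ => hterm k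

lemma gammaMeasure_Ici {m : ℕ} (hm : 1 ≤ m) {t : ℝ} (ht : 0 ≤ t) :
    gammaMeasure m m (Set.Ici t) = ENNReal.ofReal (gammaTail m t) := by
  have hm0 : (0 : ℝ) < m := by exact_mod_cast hm
  have hderiv (x : ℝ) (hx : x ∈ Set.Ici t) : HasDerivAt (gammaTail m) (-gammaPDFReal m m x) x :=
    hasDerivAt_gammaTail hm (ht.trans hx)
  have hneg (x : ℝ) (_ : x ∈ Set.Ioi t) : -gammaPDFReal m m x ≤ 0 :=
    neg_nonpos.2 (gammaPDFReal_nonneg hm0 hm0 x)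
  have hint : IntegrableOn (gammaPDFReal m m) (Set.Ioi t) := by
    simpa using (integrableOn_Ioi_deriv_of_nonpos' hderiv hneg (tendsto_gammaTail_atTop m)).neg
  have hval := integral_Ioi_of_hasDerivAt_of_nonpos' hderiv hneg (tendsto_gammaTail_atTop m)
  rw [integral_neg, zero_sub, neg_inj] at hval
  rw [gammaMeasure, withDensity_apply _ measurableSet_Ici, setLIntegral_congr Ioi_ae_eq_Ici.symm,
    ← hval, ofReal_integral_eq_lintegral_ofReal hint
      (ae_of_all _ fun x => gammaPDFReal_nonneg hm0 hm0 x)]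
  rfl

lemma gammaTail_le_one {m : ℕ} (hm : 1 ≤ m) {t : ℝ} (ht : 0 ≤ t) : gammaTail m t ≤ 1 := by
  have hm0 : (0 : ℝ) < m := by exact_mod_cast hm
  have := isProbabilityMeasure_gammaMeasure hm0 hm0
  rw [← ENNReal.ofReal_le_one, ← gammaMeasure_Ici hm ht]
  exact prob_le_one

lemma lintegral_measure_le_gammaMeasure {Ω : Type*} [MeasurableSpace Ω] {μ : Measure Ω}
    [IsFiniteMeasure μ] {m : ℕ} (hm : 1 ≤ m) {Z : Ω → ℝ} (hZ : Measurable Z) (hZ0 : ∀ ω, 0 ≤ Z ω) :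
    ∫⁻ g, μ {ω | Z ω ≤ g} ∂gammaMeasure m m = ENNReal.ofReal (∫ ω, gammaTail m (Z ω) ∂μ) := by
  have hint : Integrable (fun ω => gammaTail m (Z ω)) μ :=
    integrable_of_mem_Icc ((measurable_gammaTail m).comp hZ) fun ω =>
      ⟨gammaTail_nonneg m (hZ0 ω), gammaTail_le_one hm (hZ0 ω)⟩
  have hset : MeasurableSet {p : ℝ × Ω | Z p.2 ≤ p.1} :=
    measurableSet_le (hZ.comp measurable_snd) measurable_fst
  calc ∫⁻ g, μ {ω | Z ω ≤ g} ∂gammaMeasure m m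
      = (gammaMeasure m m).prod μ {p : ℝ × Ω | Z p.2 ≤ p.1} := (Measure.prod_apply hset).symm
    _ = ∫⁻ ω, gammaMeasure m m (Set.Ici (Z ω)) ∂μ := Measure.prod_apply_symm hset
    _ = ∫⁻ ω, ENNReal.ofReal (gammaTail m (Z ω)) ∂μ :=
        lintegral_congr fun ω => gammaMeasure_Ici hm (hZ0 ω)
    _ = _ := (ofReal_integral_eq_lintegral_ofReal hint
        (ae_of_all _ fun ω => gammaTail_nonneg m (hZ0 ω))).symm

end Gamma

section Interference

/-- The points of the marked plane that contribute to the interference: a mark `(t, g)` records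
whether the node transmits and its gain. -/
def activeRegion (c : Plane) (R : ℝ) : Set (Plane × Bool × ℝ) :=
  Metric.closedBall c R ×ˢ ({true} ×ˢ Set.univ)

/-- The normalized power received from a marked node. The absolute value changes nothing almost
surely, gains being positive, and makes the function nonnegative everywhere. -/
def receivedPower (η : ℝ) (c : Plane) (h R : ℝ) : Plane × Bool × ℝ → ℝ :=
  (activeRegion c R).indicator fun y => |y.2.2| * droneDist c h y.1 ^ (-η)

/-- The normalized interference plus noise produced by all the active nodes of a random
configuration of marked nodes. -/
def totalInterference {Ω : Type*} (Pt η σ2 : ℝ) (c : Plane) (h R : ℝ) (N : Ω → ℕ)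
    (Y : ℕ → Ω → Plane × Bool × ℝ) (ω : Ω) : ℝ :=
  shotNoise (receivedPower η c h R) (N ω) (fun i => Y i ω) + σ2 / Pt

lemma measurable_droneDist (c : Plane) (h : ℝ) : Measurable (droneDist c h) := by
  unfold droneDist
  fun_prop

lemma droneDist_pos {h : ℝ} (hh : 0 < h) (c x : Plane) : 0 < droneDist c h x :=
  Real.sqrt_pos.2 (by positivity)

lemma rpow_droneDist_nonneg (c : Plane) (h : ℝ) (x : Plane) (η : ℝ) : 0 ≤ droneDist c h x ^ η :=
  Real.rpow_nonneg (Real.sqrt_nonneg _) η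

lemma measurableSet_activeRegion (c : Plane) (R : ℝ) : MeasurableSet (activeRegion c R) :=
  Metric.isClosed_closedBall.measurableSet.prod ((measurableSet_singleton true).prod .univ)

lemma measurable_receivedPower (η : ℝ) (c : Plane) (h R : ℝ) :
    Measurable (receivedPower η c h R) := by
  have := measurable_droneDist c h
  exact Measurable.indicator (by fun_prop) (measurableSet_activeRegion c R)

lemma receivedPower_nonneg (η : ℝ) (c : Plane) (h R : ℝ) (y : Plane × Bool × ℝ) :
    0 ≤ receivedPower η c h R y :=
  Set.indicator_nonneg (fun _ _ => mul_nonneg (abs_nonneg _) (rpow_droneDist_nonneg ..)) y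

lemma totalInterference_nonneg {Ω : Type*} {Pt η σ2 : ℝ} {c : Plane} {h R : ℝ} {N : Ω → ℕ}
    {Y : ℕ → Ω → Plane × Bool × ℝ} (hPt : 0 ≤ Pt) (hσ2 : 0 ≤ σ2) (ω : Ω) :
    0 ≤ totalInterference Pt η σ2 c h R N Y ω :=
  add_nonneg (shotNoise_nonneg (receivedPower_nonneg η c h R) _ _) (div_nonneg hσ2 hPt)

lemma sum_active {M : Type*} [AddCommMonoid M] (c : Plane) (R : ℝ) (n : ℕ) (x : ℕ → Plane)
    (t : ℕ → Bool) (g : ℕ → ℝ) (f : ℕ → M) :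
    ∑ i ∈ active c R n x t, f i =
      ∑ i ∈ Finset.range n, (activeRegion c R).indicator (fun _ => f i) (x i, t i, g i) := by
  classical
  rw [active, Finset.sum_filter]
  refine Finset.sum_congr rfl fun i _ => ?_
  simp [Set.indicator_apply, activeRegion]

variable {Pt η σ2 : ℝ} {c : Plane} {h R : ℝ} {n : ℕ} {x : ℕ → Plane} {t : ℕ → Bool} {g : ℕ → ℝ}

lemma receivedPower_of_mem_active (hg : ∀ i, 0 ≤ g i) {i : ℕ} (hi : i ∈ active c R n x t) :
    receivedPower η c h R (x i, t i, g i) = g i * droneDist c h (x i) ^ (-η) := by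
  classical
  obtain ⟨-, hx, ht⟩ := Finset.mem_filter.1 hi
  have hmem : (x i, t i, g i) ∈ activeRegion c R := ⟨hx, ht, trivial⟩
  rw [receivedPower, Set.indicator_of_mem hmem, abs_of_nonneg (hg i)]

lemma shotNoise_receivedPower (hg : ∀ i, 0 ≤ g i) :
    shotNoise (receivedPower η c h R) n (fun i => (x i, t i, g i)) =
      ∑ i ∈ active c R n x t, g i * droneDist c h (x i) ^ (-η) := by
  classical
  rw [sum_active c R n x t g, shotNoise]
  refine Finset.sum_congr rfl fun i _ => ?_
  simp only [receivedPower, Set.indicator_apply, abs_of_nonneg (hg i)]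

lemma interference_of_mem_active (hg : ∀ i, 0 ≤ g i) {i : ℕ} (hi : i ∈ active c R n x t) :
    interference Pt η σ2 c h (active c R n x t) x g i =
      shotNoise (receivedPower η c h R) n (fun j => (x j, t j, g j)) -
        receivedPower η c h R (x i, t i, g i) + σ2 / Pt := by
  rw [interference, Finset.sum_erase_eq_sub hi, shotNoise_receivedPower hg,
    receivedPower_of_mem_active hg hi]

end Interference

section SINR

variable {Pt η σ2 β : ℝ} {c : Plane} {h : ℝ} {S : Finset ℕ} {x : ℕ → Plane} {g : ℕ → ℝ}

lemma interference_pos (hPt : 0 < Pt) (hσ2 : 0 < σ2) (hg : ∀ i, 0 ≤ g i) (i : ℕ) :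
    0 < interference Pt η σ2 c h S x g i :=
  add_pos_of_nonneg_of_pos (Finset.sum_nonneg fun j _ =>
    mul_nonneg (hg j) (rpow_droneDist_nonneg ..)) (div_pos hσ2 hPt)

lemma sinr_eq_div_interference (hPt : 0 < Pt) (i : ℕ) :
    sinr Pt η σ2 c h S x g i =
      g i * droneDist c h (x i) ^ (-η) / interference Pt η σ2 c h S x g i := by
  have hscale : ∑ j ∈ S.erase i, Pt * g j * droneDist c h (x j) ^ (-η) + σ2 =
      Pt * interference Pt η σ2 c h S x g i := by
    simp only [interference, mul_add, Finset.mul_sum, mul_div_cancel₀ _ hPt.ne', mul_assoc]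
  rw [sinr, hscale, mul_assoc, mul_div_mul_left _ _ hPt.ne']

lemma le_sinr_iff (hPt : 0 < Pt) (hσ2 : 0 < σ2) (hh : 0 < h) (hg : ∀ i, 0 ≤ g i) (i : ℕ) :
    β ≤ sinr Pt η σ2 c h S x g i ↔
      β * droneDist c h (x i) ^ η * interference Pt η σ2 c h S x g i ≤ g i := by
  have hD := droneDist_pos hh c (x i)
  rw [sinr_eq_div_interference hPt, le_div_iff₀ (interference_pos hPt hσ2 hg i),
    Real.rpow_neg hD.le, ← div_eq_mul_inv, le_div_iff₀ (Real.rpow_pos_of_pos hD η), mul_right_comm]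

lemma power_lt_power_of_le_sinr (hPt : 0 < Pt) (hσ2 : 0 < σ2) (hβ : 1 ≤ β) (hg : ∀ i, 0 ≤ g i)
    {i j : ℕ} (hj : j ∈ S) (hji : j ≠ i) (hi : β ≤ sinr Pt η σ2 c h S x g i) :
    g j * droneDist c h (x j) ^ (-η) < g i * droneDist c h (x i) ^ (-η) := by
  have hI := interference_pos (η := η) (c := c) (h := h) (S := S) (x := x) hPt hσ2 hg i
  rw [sinr_eq_div_interference hPt, le_div_iff₀ hI] at hi
  calc _ ≤ ∑ k ∈ S.erase i, g k * droneDist c h (x k) ^ (-η) :=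
        Finset.single_le_sum (f := fun k => g k * droneDist c h (x k) ^ (-η))
          (fun k _ => mul_nonneg (hg k) (rpow_droneDist_nonneg ..)) (Finset.mem_erase.2 ⟨hji, hj⟩)
    _ < interference Pt η σ2 c h S x g i := lt_add_of_pos_right _ (div_pos hσ2 hPt)
    _ ≤ β * interference Pt η σ2 c h S x g i := le_mul_of_one_le_left hI.le hβ
    _ ≤ _ := hi

lemma eq_of_le_sinr (hPt : 0 < Pt) (hσ2 : 0 < σ2) (hβ : 1 ≤ β) (hg : ∀ i, 0 ≤ g i) {i j : ℕ}
    (hi : i ∈ S) (hj : j ∈ S) (hβi : β ≤ sinr Pt η σ2 c h S x g i)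
    (hβj : β ≤ sinr Pt η σ2 c h S x g j) : i = j := by
  by_contra hij
  exact lt_asymm (power_lt_power_of_le_sinr hPt hσ2 hβ hg hj (Ne.symm hij) hβi)
    (power_lt_power_of_le_sinr hPt hσ2 hβ hg hi hij hβj)

/-- The positions in `A`, gains and interferences for which the signal to interference plus noise
ratio reaches the threshold `β`. -/
def successRegion (β η : ℝ) (c : Plane) (h : ℝ) (A : Set Plane) : Set (Plane × ℝ × ℝ) :=
  {p | p.1 ∈ A ∧ β * droneDist c h p.1 ^ η * p.2.2 ≤ p.2.1}

lemma measurableSet_successRegion (β η : ℝ) (c : Plane) (h : ℝ) {A : Set Plane}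
    (hA : MeasurableSet A) : MeasurableSet (successRegion β η c h A) := by
  have hD := measurable_droneDist c h
  have hle : MeasurableSet {p : Plane × ℝ × ℝ | β * droneDist c h p.1 ^ η * p.2.2 ≤ p.2.1} :=
    measurableSet_le (by fun_prop) (by fun_prop)
  exact (measurable_fst hA).inter hle

lemma lintegral_indicator_successRegion {Ω : Type*} [MeasurableSpace Ω] {μ : Measure Ω}
    [IsFiniteMeasure μ] {m : ℕ} (hm : 1 ≤ m) (hβ : 0 ≤ β) (A : Set Plane) {Z : Ω → ℝ}
    (hZ : Measurable Z) (hZ0 : ∀ ω, 0 ≤ Z ω) (x : Plane) :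
    ∫⁻ g, ∫⁻ ω, (successRegion β η c h A).indicator 1 (x, g, Z ω) ∂μ ∂gammaMeasure m m =
      A.indicator (fun x => ENNReal.ofReal
        (∫ ω, gammaTail m (β * droneDist c h x ^ η * Z ω) ∂μ)) x := by
  classical
  have hb : 0 ≤ β * droneDist c h x ^ η := mul_nonneg hβ (rpow_droneDist_nonneg c h x η)
  by_cases hx : x ∈ A
  · rw [Set.indicator_of_mem hx, ← lintegral_measure_le_gammaMeasure hm (hZ.const_mul _)
      fun ω => mul_nonneg hb (hZ0 ω)]
    refine lintegral_congr fun g => ?_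
    rw [← lintegral_indicator_one (measurableSet_le (hZ.const_mul _) measurable_const)]
    refine lintegral_congr fun ω => ?_
    simp [successRegion, Set.indicator_apply, hx]
  · simp [successRegion, hx]

open Classical in
lemma ite_exists_le_sinr (hPt : 0 < Pt) (hσ2 : 0 < σ2) (hh : 0 < h) (hβ : 1 ≤ β)
    (hg : ∀ i, 0 ≤ g i) (A : Set Plane) :
    (if ∃ i ∈ S, x i ∈ A ∧ β ≤ sinr Pt η σ2 c h S x g i then 1 else 0 : ℝ≥0∞) =
      ∑ i ∈ S, (successRegion β η c h A).indicator 1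
        (x i, g i, interference Pt η σ2 c h S x g i) := by
  simp only [successRegion, Set.indicator_apply, Set.mem_ofPred_eq, Pi.one_apply,
    ← le_sinr_iff hPt hσ2 hh hg]
  refine (Finset.sum_ite_zero S _ (fun i hi j hj hβi hβj => ?_) 1).symm
  exact eq_of_le_sinr hPt hσ2 hβ hg hi hj hβi.2 hβj.2

end SINR

section Derivatives

variable {Ω : Type*} [MeasurableSpace Ω] {μ : Measure Ω} {Z : Ω → ℝ} {L : ℝ → ℝ}

lemma mem_interior_integrableExpSet_of_neg [IsFiniteMeasure μ] (hZ : AEMeasurable Z μ)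
    (hZ0 : 0 ≤ᵐ[μ] Z) {s : ℝ} (hs : s < 0) : s ∈ interior (integrableExpSet Z μ) := by
  refine mem_interior.2 ⟨Set.Iio 0, fun u (hu : u < 0) => ?_, isOpen_Iio, hs⟩
  refine (integrable_const (1 : ℝ)).mono' (by fun_prop) (hZ0.mono fun ω hω => ?_)
  rw [Real.norm_of_nonneg (Real.exp_pos _).le]
  exact Real.exp_le_one_iff.2 (mul_nonpos_of_nonpos_of_nonneg hu.le hω)

lemma iteratedDeriv_of_mgf_neg [IsFiniteMeasure μ] (hZ : AEMeasurable Z μ) (hZ0 : 0 ≤ᵐ[μ] Z)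
    (hL : ∀ s, 0 < s → mgf Z μ (-s) = L s) {s : ℝ} (hs : 0 < s) (k : ℕ) :
    iteratedDeriv k L s = (-1) ^ k * ∫ ω, Z ω ^ k * Real.exp (-s * Z ω) ∂μ := by
  have hloc : L =ᶠ[𝓝 s] fun s => mgf Z μ (-s) := by
    filter_upwards [Ioi_mem_nhds hs] with u hu using (hL u hu).symm
  rw [hloc.iteratedDeriv_eq k, iteratedDeriv_comp_neg, iteratedDeriv_mgf
    (mem_interior_integrableExpSet_of_neg hZ hZ0 (neg_lt_zero.2 hs)), smul_eq_mul]

lemma integral_gammaTail_mul [IsFiniteMeasure μ] (hZ : AEMeasurable Z μ) (hZ0 : 0 ≤ᵐ[μ] Z)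
    (hL : ∀ s, 0 < s → mgf Z μ (-s) = L s) {m : ℕ} {b : ℝ} (hb : 0 < m * b) :
    ∫ ω, gammaTail m (b * Z ω) ∂μ = ∑ k ∈ Finset.range m,
      (-(m * b)) ^ k / (k.factorial : ℝ) * iteratedDeriv k L (m * b) := by
  have hexpand (ω : Ω) : gammaTail m (b * Z ω) = ∑ k ∈ Finset.range m,
      (m * b) ^ k / (k.factorial : ℝ) * (Z ω ^ k * Real.exp (-(m * b) * Z ω)) := by
    refine Finset.sum_congr rfl fun k _ => ?_
    rw [← mul_assoc (m : ℝ), mul_pow (m * b) (Z ω) k, neg_mul]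
    ring
  have hint (k : ℕ) : Integrable (fun ω => (m * b) ^ k / (k.factorial : ℝ) *
      (Z ω ^ k * Real.exp (-(m * b) * Z ω))) μ :=
    (integrable_pow_mul_exp_of_mem_interior_integrableExpSet
      (mem_interior_integrableExpSet_of_neg hZ hZ0 (neg_lt_zero.2 hb)) k).const_mul _
  simp only [hexpand]
  rw [integral_finsetSum _ fun k _ => hint k]
  refine Finset.sum_congr rfl fun k _ => ?_
  rw [integral_const_mul, iteratedDeriv_of_mgf_neg hZ hZ0 hL hb, neg_pow]
  have hsign : (-1 : ℝ) ^ k * (-1) ^ k = 1 := by rw [← mul_pow]; simp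
  linear_combination -((m * b) ^ k / (k.factorial : ℝ) *
    ∫ ω, Z ω ^ k * Real.exp (-(m * b) * Z ω) ∂μ) * hsign

end Derivatives

section MarkedNodes

/-- The law of the mark of a node: an independent pair of a transmission decision, `true` with
probability `a`, and a Gamma distributed gain. -/
def markLaw (a : ℝ) (m : ℕ) : Measure (Bool × ℝ) :=
  (ENNReal.ofReal a • Measure.dirac true + ENNReal.ofReal (1 - a) • Measure.dirac false).prod
    (gammaMeasure m m)

/-- The intensity of the Poisson process of marked nodes. -/
def slotIntensity (lam a : ℝ) (m : ℕ) (𝒜 : Set Plane) : Measure (Plane × Bool × ℝ) :=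
  (ENNReal.ofReal lam • volume.restrict 𝒜).prod (markLaw a m)

variable {lam a : ℝ} {m : ℕ} {𝒜 : Set Plane}

lemma setLIntegral_activeRegion (hlam : 0 ≤ lam) {c : Plane} {R : ℝ}
    (hc : Metric.closedBall c R ⊆ 𝒜) {F : Plane × ℝ → ℝ≥0∞} (hF : Measurable F) :
    ∫⁻ y in activeRegion c R, F (y.1, y.2.2) ∂slotIntensity lam a m 𝒜 =
      ENNReal.ofReal (a * lam) *
        ∫⁻ x in Metric.closedBall c R, ∫⁻ g, F (x, g) ∂gammaMeasure m m := by
  have hdecision : (ENNReal.ofReal a • Measure.dirac true +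
      ENNReal.ofReal (1 - a) • Measure.dirac false).restrict {true} =
        ENNReal.ofReal a • Measure.dirac true := by
    simp
  have hregion : (slotIntensity lam a m 𝒜).restrict (activeRegion c R) =
      (ENNReal.ofReal lam • volume.restrict (Metric.closedBall c R)).prod
        ((ENNReal.ofReal a • Measure.dirac true).prod (gammaMeasure m m)) := by
    rw [slotIntensity, markLaw, activeRegion, ← Measure.prod_restrict, ← Measure.prod_restrict,
      hdecision, Measure.restrict_univ, Measure.restrict_smul,
      Measure.restrict_restrict Metric.isClosed_closedBall.measurableSet,
      Set.inter_eq_left.2 hc]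
  have hmark (x : Plane) : ∫⁻ y, F (x, y.2)
      ∂(ENNReal.ofReal a • Measure.dirac true).prod (gammaMeasure m m) =
        ENNReal.ofReal a * ∫⁻ g, F (x, g) ∂gammaMeasure m m := by
    have := lintegral_prod (μ := ENNReal.ofReal a • Measure.dirac true) (ν := gammaMeasure m m)
      (fun y => F (x, y.2)) (by fun_prop)
    simpa [mul_comm] using this
  rw [hregion, lintegral_prod _ (by fun_prop)]
  simp only [hmark]
  rw [lintegral_smul_measure, lintegral_const_mul _ hF.lintegral_prod_right', smul_eq_mul,
    ← mul_assoc, mul_comm a, ENNReal.ofReal_mul hlam]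

end MarkedNodes

section Laplace

variable {lam a Pt η σ2 h R s : ℝ} {m : ℕ} {𝒜 : Set Plane} {c : Plane}

lemma one_add_zpow_neg_le_one (m : ℕ) {u : ℝ} (hu : 0 ≤ u) : (1 + u / m) ^ (-(m : ℤ)) ≤ 1 := by
  have hbase : (1 : ℝ) ≤ 1 + u / m := le_add_of_nonneg_right (by positivity)
  rw [zpow_neg, zpow_natCast]
  exact inv_le_one_of_one_le₀ (one_le_pow₀ hbase)

lemma lintegral_one_sub_exp_receivedPower (hlam : 0 ≤ lam) (hm : 1 ≤ m)
    (hc : Metric.closedBall c R ⊆ 𝒜) (hs : 0 ≤ s) :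
    ∫⁻ y, ENNReal.ofReal (1 - Real.exp (-s * receivedPower η c h R y)) ∂slotIntensity lam a m 𝒜 =
      ENNReal.ofReal (a * lam) * ∫⁻ x in Metric.closedBall c R,
        ENNReal.ofReal (1 - (1 + s * droneDist c h x ^ (-η) / m) ^ (-(m : ℤ))) := by
  have hindicator (y : Plane × Bool × ℝ) :
      ENNReal.ofReal (1 - Real.exp (-s * receivedPower η c h R y)) =
        (activeRegion c R).indicator (fun y => ENNReal.ofReal
          (1 - Real.exp (-(s * droneDist c h y.1 ^ (-η)) * |y.2.2|))) y := by
    by_cases hy : y ∈ activeRegion c R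
    · simp only [receivedPower, Set.indicator_of_mem hy]
      ring_nf
    · simp [receivedPower, hy]
  have hD := measurable_droneDist c h
  simp only [hindicator]
  rw [lintegral_indicator (measurableSet_activeRegion c R), setLIntegral_activeRegion hlam hc
    (F := fun p => ENNReal.ofReal (1 - Real.exp (-(s * droneDist c h p.1 ^ (-η)) * |p.2|)))
    (by fun_prop)]
  simp only [lintegral_one_sub_exp_neg_mul_abs_gammaMeasure hm
    (mul_nonneg hs (rpow_droneDist_nonneg c h _ (-η)))]

lemma integral_exp_receivedPower_sub_one (hlam : 0 ≤ lam) (ha : 0 ≤ a) (hm : 1 ≤ m) (hh : 0 < h)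
    (hR : 0 < R) (hc : Metric.closedBall c R ⊆ 𝒜) (hs : 0 ≤ s) :
    ∫ y, (Real.exp (-s * receivedPower η c h R y) - 1) ∂slotIntensity lam a m 𝒜 =
      -2 * Real.pi * lam * a *
        ∫ r in h..√(h ^ 2 + R ^ 2), (1 - (1 + s * r ^ (-η) / m) ^ (-(m : ℤ))) * r := by
  have hu := measurable_receivedPower η c h R
  have hnonneg (y : Plane × Bool × ℝ) : 0 ≤ 1 - Real.exp (-s * receivedPower η c h R y) := by
    rw [sub_nonneg, Real.exp_le_one_iff, neg_mul, neg_nonpos]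
    exact mul_nonneg hs (receivedPower_nonneg η c h R y)
  have hdisk := toReal_setLIntegral_disk hh hR c
    (f := fun r => 1 - (1 + s * r ^ (-η) / m) ^ (-(m : ℤ)))
    (by fun_prop)
    fun r hr => sub_nonneg.2 (one_add_zpow_neg_le_one m (by positivity))
  simp only [← neg_sub (1 : ℝ)]
  rw [integral_neg, integral_eq_lintegral_of_nonneg_ae (ae_of_all _ hnonneg) (by fun_prop),
    lintegral_one_sub_exp_receivedPower hlam hm hc hs, ENNReal.toReal_mul, hdisk,
    ENNReal.toReal_ofReal (by positivity)]
  ring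

variable {Ω : Type*} [MeasurableSpace Ω] {Pr : Measure Ω} {N : Ω → ℕ}
  {Y : ℕ → Ω → Plane × Bool × ℝ}

lemma measurable_totalInterference (hY : IsPPP Pr (slotIntensity lam a m 𝒜) N Y) :
    Measurable (totalInterference Pt η σ2 c h R N Y) :=
  (hY.measurable_shotNoise (measurable_receivedPower η c h R)).add_const _

theorem mgf_totalInterference (hY : IsPPP Pr (slotIntensity lam a m 𝒜) N Y)
    (hlam : 0 ≤ lam) (ha : 0 ≤ a) (hm : 1 ≤ m) (hh : 0 < h) (hR : 0 < R)
    (hc : Metric.closedBall c R ⊆ 𝒜) (hs : 0 ≤ s) :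
    mgf (totalInterference Pt η σ2 c h R N Y) Pr (-s) = laplaceI lam a Pt η σ2 h R m s := by
  unfold totalInterference laplaceI
  rw [mgf_add_const, hY.mgf_shotNoise (measurable_receivedPower η c h R) (C := 0) fun y =>
    mul_nonpos_of_nonpos_of_nonneg (neg_nonpos.2 hs) (receivedPower_nonneg η c h R y),
    integral_exp_receivedPower_sub_one hlam ha hm hh hR hc hs, mul_comm, mul_div_assoc]

end Laplace

namespace IsSlot

variable {lam a Pt η σ2 h R β s : ℝ} {m : ℕ} {𝒜 : Set Plane} {c : Plane} {Ω : Type*}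
  [MeasurableSpace Ω] {Pr : Measure Ω} {N : Ω → ℕ} {X : ℕ → Ω → Plane} {T : ℕ → Ω → Bool}
  {G : ℕ → Ω → ℝ}

lemma ae_gain_nonneg (hs : IsSlot Pr lam a m 𝒜 N X T G) : ∀ᵐ ω ∂Pr, ∀ i, 0 ≤ G i ω := by
  refine ae_all_iff.2 fun i => ae_of_ae_map (hs.measurable_gain i).aemeasurable ?_
  rw [hs.gain_law i]
  exact ae_nonneg_gammaMeasure m m

lemma sum_active_interference_ae_eq (hs : IsSlot Pr lam a m 𝒜 N X T G)
    (F : Plane × ℝ × ℝ → ℝ≥0∞) :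
    (fun ω => ∑ i ∈ active c R (N ω) (fun j => X j ω) (fun j => T j ω),
        F (X i ω, G i ω, interference Pt η σ2 c h
          (active c R (N ω) (fun j => X j ω) (fun j => T j ω)) (fun j => X j ω)
          (fun j => G j ω) i)) =ᵐ[Pr]
      fun ω => ∑ i ∈ Finset.range (N ω), (Prod.fst ⁻¹' activeRegion c R).indicator
        (fun p : (Plane × Bool × ℝ) × ℝ => F (p.1.1, p.1.2.2, p.2 + σ2 / Pt))
        ((X i ω, T i ω, G i ω),
          shotNoise (receivedPower η c h R) (N ω) (fun j => (X j ω, T j ω, G j ω)) -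
            receivedPower η c h R (X i ω, T i ω, G i ω)) := by
  classical
  filter_upwards [hs.ae_gain_nonneg] with ω hG
  rw [Finset.sum_congr rfl fun i hi => by rw [interference_of_mem_active hG hi],
    sum_active c R (N ω) _ _ fun j => G j ω]
  rfl

lemma indicator_exists_le_sinr_ae_eq (hs : IsSlot Pr lam a m 𝒜 N X T G) (hPt : 0 < Pt)
    (hσ2 : 0 < σ2) (hh : 0 < h) (hβ : 1 ≤ β) (A : Set Plane) :
    {ω | ∃ i ∈ active c R (N ω) (fun j => X j ω) (fun j => T j ω), X i ω ∈ A ∧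
        β ≤ sinr Pt η σ2 c h (active c R (N ω) (fun j => X j ω) (fun j => T j ω))
          (fun j => X j ω) (fun j => G j ω) i}.indicator (1 : Ω → ℝ≥0∞) =ᵐ[Pr]
      fun ω => ∑ i ∈ active c R (N ω) (fun j => X j ω) (fun j => T j ω),
        (successRegion β η c h A).indicator 1
          (X i ω, G i ω, interference Pt η σ2 c h
            (active c R (N ω) (fun j => X j ω) (fun j => T j ω)) (fun j => X j ω)
            (fun j => G j ω) i) := by
  classical
  filter_upwards [hs.ae_gain_nonneg] with ω hG
  rw [← ite_exists_le_sinr hPt hσ2 hh hβ hG, Set.indicator_apply]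
  congr

variable [IsProbabilityMeasure Pr]

lemma map_decision (hs : IsSlot Pr lam a m 𝒜 N X T G) (i : ℕ) : Pr.map (T i) =
    ENNReal.ofReal a • Measure.dirac true + ENNReal.ofReal (1 - a) • Measure.dirac false := by
  have hT := hs.measurable_decision i
  have htrue : Pr.real (T i ⁻¹' {true}) = a := hs.decision_law i
  have hfalse : Pr.real (T i ⁻¹' {false}) = 1 - a := by
    rw [← htrue, ← probReal_compl_eq_one_sub (hT (measurableSet_singleton true)),
      ← Set.preimage_compl, Bool.compl_singleton, Bool.not_true]
  refine Measure.ext_of_singleton fun b => ?_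
  rw [Measure.map_apply hT (measurableSet_singleton b), ← ofReal_measureReal]
  cases b
  · simp [hfalse]
  · simp [htrue]

lemma map_mark (hs : IsSlot Pr lam a m 𝒜 N X T G) (i : ℕ) :
    Pr.map (fun ω => (T i ω, G i ω)) = markLaw a m := by
  rw [(indepFun_iff_map_prod_eq_prod_map_map (hs.measurable_decision i).aemeasurable
    (hs.measurable_gain i).aemeasurable).1 (hs.decision_indep_gain i), hs.map_decision, hs.gain_law,
    markLaw]

theorem isPPP (hs : IsSlot Pr lam a m 𝒜 N X T G) (hlam : 0 ≤ lam)
    (h𝒜 : volume 𝒜 ≠ ⊤) :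
    IsPPP Pr (slotIntensity lam a m 𝒜) N fun i ω => (X i ω, T i ω, G i ω) :=
  (hs.nodes.isPPP hlam h𝒜).marked
    (fun i => (hs.measurable_decision i).prodMk (hs.measurable_gain i)) hs.marks_indep hs.map_mark
    hs.marks_indep_nodes

lemma aemeasurable_sum_active_interference (hs : IsSlot Pr lam a m 𝒜 N X T G) (hlam : 0 ≤ lam)
    (h𝒜 : volume 𝒜 ≠ ⊤) {F : Plane × ℝ × ℝ → ℝ≥0∞} (hF : Measurable F) :
    AEMeasurable (fun ω => ∑ i ∈ active c R (N ω) (fun j => X j ω) (fun j => T j ω),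
      F (X i ω, G i ω, interference Pt η σ2 c h
        (active c R (N ω) (fun j => X j ω) (fun j => T j ω)) (fun j => X j ω)
        (fun j => G j ω) i)) Pr := by
  have hY := hs.isPPP hlam h𝒜
  have hS := hY.measurable_shotNoise (measurable_receivedPower η c h R)
  refine (hY.measurable_sum fun i => ?_).aemeasurable.congr
    (hs.sum_active_interference_ae_eq F).symm
  have hYi := hY.measurable_point i
  refine Measurable.comp (Measurable.indicator (by fun_prop)
    (measurable_fst (measurableSet_activeRegion c R))) (hYi.prodMk (hS.sub ?_))
  exact (measurable_receivedPower η c h R).comp hYi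

theorem lintegral_sum_active_interference (hs : IsSlot Pr lam a m 𝒜 N X T G) (hlam : 0 ≤ lam)
    (h𝒜 : volume 𝒜 ≠ ⊤) (hc : Metric.closedBall c R ⊆ 𝒜) {F : Plane × ℝ × ℝ → ℝ≥0∞}
    (hF : Measurable F) :
    ∫⁻ ω, ∑ i ∈ active c R (N ω) (fun j => X j ω) (fun j => T j ω),
        F (X i ω, G i ω, interference Pt η σ2 c h
          (active c R (N ω) (fun j => X j ω) (fun j => T j ω)) (fun j => X j ω)
          (fun j => G j ω) i) ∂Pr =
      ENNReal.ofReal (a * lam) * ∫⁻ x in Metric.closedBall c R, ∫⁻ g, ∫⁻ ω,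
        F (x, g, totalInterference Pt η σ2 c h R N (fun i ω => (X i ω, T i ω, G i ω)) ω)
          ∂Pr ∂gammaMeasure m m := by
  have hY := hs.isPPP hlam h𝒜
  have hu := measurable_receivedPower η c h R
  have hregion := measurableSet_activeRegion c R
  have hJ : Measurable fun ω => totalInterference Pt η σ2 c h R N
    (fun i ω => (X i ω, T i ω, G i ω)) ω := measurable_totalInterference hY
  have hmean (y : Plane × Bool × ℝ) : ∫⁻ ω, (Prod.fst ⁻¹' activeRegion c R).indicator
      (fun p : (Plane × Bool × ℝ) × ℝ => F (p.1.1, p.1.2.2, p.2 + σ2 / Pt))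
      (y, shotNoise (receivedPower η c h R) (N ω) fun i => (X i ω, T i ω, G i ω)) ∂Pr =
      (activeRegion c R).indicator (fun y => ∫⁻ ω, F (y.1, y.2.2,
        totalInterference Pt η σ2 c h R N (fun i ω => (X i ω, T i ω, G i ω)) ω) ∂Pr) y := by
    by_cases hy : y ∈ activeRegion c R
    · simp [hy, totalInterference]
    · simp [hy]
  rw [lintegral_congr_ae (hs.sum_active_interference_ae_eq F),
    hY.lintegral_sum_sub_shotNoise hu (receivedPower_nonneg η c h R)
      (Measurable.indicator (by fun_prop) (measurable_fst hregion)), lintegral_congr hmean,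
    lintegral_indicator hregion]
  have hFJ : Measurable fun q : (Plane × ℝ) × Ω => F (q.1.1, q.1.2,
      totalInterference Pt η σ2 c h R N (fun i ω => (X i ω, T i ω, G i ω)) q.2) := by fun_prop
  exact setLIntegral_activeRegion hlam hc hFJ.lintegral_prod_right'

theorem measure_exists_le_sinr (hs : IsSlot Pr lam a m 𝒜 N X T G) (hlam : 0 ≤ lam)
    (h𝒜 : volume 𝒜 ≠ ⊤) (hc : Metric.closedBall c R ⊆ 𝒜) (hm : 1 ≤ m) (hPt : 0 < Pt)
    (hσ2 : 0 < σ2) (hh : 0 < h) (hβ : 1 ≤ β) {A : Set Plane} (hA : MeasurableSet A)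
    (hAc : A ⊆ Metric.closedBall c R) :
    Pr {ω | ∃ i ∈ active c R (N ω) (fun j => X j ω) (fun j => T j ω), X i ω ∈ A ∧
        β ≤ sinr Pt η σ2 c h (active c R (N ω) (fun j => X j ω) (fun j => T j ω))
          (fun j => X j ω) (fun j => G j ω) i} =
      ENNReal.ofReal (a * lam) * ∫⁻ x in A, ENNReal.ofReal (∫ ω, gammaTail m
        (β * droneDist c h x ^ η *
          totalInterference Pt η σ2 c h R N (fun i ω => (X i ω, T i ω, G i ω)) ω) ∂Pr) := by
  have hF := (measurable_one (α := ℝ≥0∞)).indicator (measurableSet_successRegion β η c h hA)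
  have hae := hs.indicator_exists_le_sinr_ae_eq (R := R) (c := c) (η := η) hPt hσ2 hh hβ A
  have hE := (hs.aemeasurable_sum_active_interference hlam h𝒜 hF).congr hae.symm
  have hJ : Measurable (totalInterference Pt η σ2 c h R N fun i ω => (X i ω, T i ω, G i ω)) :=
    measurable_totalInterference (hs.isPPP hlam h𝒜)
  rw [← lintegral_indicator_one₀ ((aemeasurable_indicator_const_iff 1).1 hE),
    lintegral_congr_ae hae, hs.lintegral_sum_active_interference hlam h𝒜 hc hF,
    lintegral_congr fun x => lintegral_indicator_successRegion hm (zero_le_one.trans hβ) A hJ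
      (totalInterference_nonneg hPt.le hσ2.le) x,
    setLIntegral_indicator hA, Set.inter_eq_left.2 hAc]

theorem measureReal_exists_le_sinr (hs : IsSlot Pr lam a m 𝒜 N X T G) (hlam : 0 ≤ lam)
    (ha : 0 ≤ a) (h𝒜 : volume 𝒜 ≠ ⊤) (hc : Metric.closedBall c R ⊆ 𝒜) (hm : 1 ≤ m) (hPt : 0 < Pt)
    (hσ2 : 0 < σ2) (hh : 0 < h) (hR : 0 < R) (hβ : 1 ≤ β) {e : Plane} {ρ : ℝ} (hρ : 0 < ρ)
    (he : dist e c = R) :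
    Pr.real {ω | ∃ i ∈ active c R (N ω) (fun j => X j ω) (fun j => T j ω),
        X i ω ∈ Metric.closedBall e ρ ∩ Metric.closedBall c R ∧
        β ≤ sinr Pt η σ2 c h (active c R (N ω) (fun j => X j ω) (fun j => T j ω))
          (fun j => X j ω) (fun j => G j ω) i} =
      a * lam * ∫ r in h..√(h ^ 2 + R ^ 2),
        (∑ k ∈ Finset.range m, (-(m * β * r ^ η)) ^ k / (k.factorial : ℝ) *
          iteratedDeriv k (laplaceI lam a Pt η σ2 h R m) (m * β * r ^ η)) *
        r * theta R ρ (√(r ^ 2 - h ^ 2)) := by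
  have hY := hs.isPPP hlam h𝒜
  let J := totalInterference Pt η σ2 c h R N fun i ω => (X i ω, T i ω, G i ω)
  have hJ : Measurable J := measurable_totalInterference hY
  have hJ0 (ω : Ω) : 0 ≤ J ω := totalInterference_nonneg hPt.le hσ2.le ω
  have hsuccess : Measurable fun r : ℝ => ∫ ω, gammaTail m (β * r ^ η * J ω) ∂Pr := by
    have := measurable_gammaTail m
    refine (StronglyMeasurable.integral_prod_right
      (f := fun r ω => gammaTail m (β * r ^ η * J ω)) ?_).measurable
    exact Measurable.stronglyMeasurable (by fun_prop)
  have hsuccess0 (r : ℝ) (hr : 0 < r) : 0 ≤ ∫ ω, gammaTail m (β * r ^ η * J ω) ∂Pr :=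
    integral_nonneg fun ω => gammaTail_nonneg m (mul_nonneg (by positivity) (hJ0 ω))
  have hderiv (r : ℝ) (hr : 0 < r) : ∫ ω, gammaTail m (β * r ^ η * J ω) ∂Pr =
      ∑ k ∈ Finset.range m, (-(m * β * r ^ η)) ^ k / (k.factorial : ℝ) *
        iteratedDeriv k (laplaceI lam a Pt η σ2 h R m) (m * β * r ^ η) := by
    have : (0 : ℝ) < m := by exact_mod_cast hm
    simpa only [mul_assoc] using integral_gammaTail_mul hJ.aemeasurable (ae_of_all _ hJ0)
      (fun s hs => mgf_totalInterference hY hlam ha hm hh hR hc hs.le)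
      (b := β * r ^ η) (by positivity)
  rw [measureReal_def, hs.measure_exists_le_sinr hlam h𝒜 hc hm hPt hσ2 hh hβ
    (Metric.isClosed_closedBall.inter Metric.isClosed_closedBall).measurableSet
    Set.inter_subset_right, ENNReal.toReal_mul, ENNReal.toReal_ofReal (by positivity),
    toReal_setLIntegral_lens hh hR hρ he hsuccess hsuccess0]
  congr 1
  refine intervalIntegral.integral_congr fun r hr => ?_
  rw [Set.uIcc_of_le (Real.le_sqrt_of_sq_le (by nlinarith))] at hr
  simp only [hderiv r (hh.trans_le hr.1)]

theorem integral_sum_active_exp_interference (hs : IsSlot Pr lam a m 𝒜 N X T G) (hlam : 0 ≤ lam)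
    (ha : 0 ≤ a) (h𝒜 : volume 𝒜 ≠ ⊤) (hc : Metric.closedBall c R ⊆ 𝒜) (hm : 1 ≤ m)
    (hh : 0 < h) (hR : 0 < R) (hs0 : 0 ≤ s) {B : Set Plane} (hB : MeasurableSet B)
    (hBc : B ⊆ Metric.closedBall c R) :
    ∫ ω, ∑ i ∈ active c R (N ω) (fun j => X j ω) (fun j => T j ω),
        B.indicator (fun _ => Real.exp (-s * interference Pt η σ2 c h
          (active c R (N ω) (fun j => X j ω) (fun j => T j ω)) (fun j => X j ω)
          (fun j => G j ω) i)) (X i ω) ∂Pr =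
      a * lam * volume.real B * laplaceI lam a Pt η σ2 h R m s := by
  classical
  let J := totalInterference Pt η σ2 c h R N fun i ω => (X i ω, T i ω, G i ω)
  let F : Plane × ℝ × ℝ → ℝ≥0∞ :=
    (Prod.fst ⁻¹' B).indicator fun p => ENNReal.ofReal (Real.exp (-s * p.2.2))
  have hF : Measurable F := Measurable.indicator (by fun_prop) (measurable_fst hB)
  have hY := hs.isPPP hlam h𝒜
  have hJ : Measurable J := measurable_totalInterference hY
  have hFtop (p : Plane × ℝ × ℝ) : F p ≠ ⊤ := by
    by_cases hp : p.1 ∈ B <;> simp [F, hp]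
  have hF_toReal (x : Plane) (g t : ℝ) :
      B.indicator (fun _ => Real.exp (-s * t)) x = (F (x, g, t)).toReal := by
    by_cases hx : x ∈ B <;> simp [F, hx, Real.exp_nonneg]
  have hlaplace : (∫⁻ ω, ENNReal.ofReal (Real.exp (-s * J ω)) ∂Pr).toReal =
      laplaceI lam a Pt η σ2 h R m s := by
    rw [← integral_eq_lintegral_of_nonneg_ae (ae_of_all _ fun ω => Real.exp_nonneg _)
      (by fun_prop)]
    exact mgf_totalInterference hY hlam ha hm hh hR hc hs0
  have hinner (x : Plane) : ∫⁻ g, ∫⁻ ω, F (x, g, J ω) ∂Pr ∂gammaMeasure m m =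
      B.indicator (fun _ => ∫⁻ ω, ENNReal.ofReal (Real.exp (-s * J ω)) ∂Pr) x := by
    have hm0 : (0 : ℝ) < m := by exact_mod_cast hm
    have := isProbabilityMeasure_gammaMeasure hm0 hm0
    by_cases hx : x ∈ B <;> simp [F, hx]
  rw [integral_congr_ae (ae_of_all _ fun ω => (Finset.sum_congr rfl fun i _ =>
      hF_toReal (X i ω) (G i ω) _).trans (ENNReal.toReal_sum fun _ _ => hFtop _).symm),
    integral_toReal (hs.aemeasurable_sum_active_interference hlam h𝒜 hF)
      (ae_of_all _ fun _ => ENNReal.sum_lt_top.2 fun _ _ => (hFtop _).lt_top),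
    hs.lintegral_sum_active_interference hlam h𝒜 hc hF, lintegral_congr hinner,
    setLIntegral_indicator hB, Set.inter_eq_left.2 hBc, setLIntegral_const, ENNReal.toReal_mul,
    ENNReal.toReal_mul, hlaplace, ENNReal.toReal_ofReal (by positivity), measureReal_def]
  ring

end IsSlot

end UAV

end

theorem theorem2 {Ω : Type*} [MeasurableSpace Ω] (Pr : Measure Ω) [IsProbabilityMeasure Pr]
    (lam a Pt η σ2 h R Rmse β : ℝ) (m : ℕ)
    (hlam : 0 < lam) (ha0 : 0 ≤ a) (ha1 : a ≤ 1) (hPt : 0 < Pt) (hη : 0 < η) (hσ2 : 0 < σ2)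
    (hh : 0 < h) (hR : 0 < R) (hRmse : 0 < Rmse) (hβ : 1 ≤ β) (hm : 1 ≤ m)
    (𝒜 : Set UAV.Plane) (h𝒜 : MeasurableSet 𝒜) (h𝒜fin : volume 𝒜 ≠ ⊤)
    -- `c` is the centre of the hovering disk, `e` a point on its edge
    (c e : UAV.Plane) (hc : Metric.closedBall c R ⊆ 𝒜) (he : dist e c = R)
    (N : Ω → ℕ) (X : ℕ → Ω → UAV.Plane) (T : ℕ → Ω → Bool) (G : ℕ → Ω → ℝ)
    (hmodel : UAV.IsSlot Pr lam a m 𝒜 N X T G) :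
    -- the probability of a successful transmission from the intersection of the two disks
    Pr.real {ω | ∃ i ∈ UAV.active c R (N ω) (fun j => X j ω) (fun j => T j ω),
        X i ω ∈ Metric.closedBall e Rmse ∩ Metric.closedBall c R ∧
        β ≤ UAV.sinr Pt η σ2 c h (UAV.active c R (N ω) (fun j => X j ω) (fun j => T j ω))
          (fun j => X j ω) (fun j => G j ω) i} =
      a * lam * ∫ r in h..√(h ^ 2 + R ^ 2),
        (∑ k ∈ Finset.range m, (-(m * β * r ^ η)) ^ k / (k.factorial : ℝ) *
          iteratedDeriv k (UAV.laplaceI lam a Pt η σ2 h R m) (m * β * r ^ η)) *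
        r * UAV.theta R Rmse (√(r ^ 2 - h ^ 2)) ∧
    -- `laplaceI` is the Laplace transform of the normalized interference plus noise seen by the
    -- signal of an active node, whatever the position of that node (Palm distribution)
    ∀ s : ℝ, 0 ≤ s → ∀ B : Set UAV.Plane, MeasurableSet B → B ⊆ Metric.closedBall c R →
      ∫ ω, ∑ i ∈ UAV.active c R (N ω) (fun j => X j ω) (fun j => T j ω),
          B.indicator (fun _ => Real.exp (-s * UAV.interference Pt η σ2 c h
            (UAV.active c R (N ω) (fun j => X j ω) (fun j => T j ω))
            (fun j => X j ω) (fun j => G j ω) i)) (X i ω) ∂Pr =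
        a * lam * volume.real B * UAV.laplaceI lam a Pt η σ2 h R m s :=
  ⟨hmodel.measureReal_exists_le_sinr hlam.le ha0 h𝒜fin hc hm hPt hσ2 hh hR hβ hRmse he,
    fun _ hs _ hB hBc =>
      hmodel.integral_sum_active_exp_interference hlam.le ha0 h𝒜fin hc hm hh hR hs hB hBc⟩
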